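/- Let $X(t)$, $t\in\mathbb R$, be a jointly measurable, mean-square continuous, real-valued, stationary, zero-mean Gaussian process on a probability space, whose covariance function is $\mathrm{Cov}(X(t),X(t'))=\int_{\mathbb R}e^{iu(t-t')}f(u)\,du$ with the integrable spectral density $$f(\lambda)=\frac{h(\lambda)}{|\lambda^2-s_0^2|^{2\alpha}},\qquad \lambda\in\mathbb R,$$ where $s_0>1$, $\alpha\in(0,1/2)$, and $h$ is an even, non-negative, bounded, four times continuously differentiable function with $h(0)=1$, $h^{(i)}(0)=0$ for $i=1,2,3,4$, $h>0$ in some neighbourhood of $\pm s_0$, and $\int_{\mathbb R}h(\lambda)(1+|\lambda|)^{-\varepsilon}\,d\lambda<\infty$ for all $\varepsilon>0$. Let $\psi\in L_1(\mathbb R)$ be real-valued and not almost everywhere zero, and suppose that its Fourier transform $\widehat\psi(\lambda)=\int_{\mathbb R}e^{-i\lambda t}\psi(t)\,dt$ is supported in $[-A,A]$ for some $A>0$ and is of bounded variation on $[-A,A]$. Let $(a_j)_{j\in\mathbb N}$ be a strictly increasing unbounded sequence of positive real numbers, $(m_j)_{j\in\mathbb N}$ a non-decreasing unbounded sequence of positive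 integers, $(\gamma_j)_{j\in\mathbb N}$ a sequence of positive real numbers, and $(b_{jk})_{(j,k)\in\mathbb N\times\mathbb Z}$ an array of real numbers such that $|b_{jk}-b_{jl}|\ge\gamma_j|k-l|$ for all $j\in\mathbb N$ and $k,l\in\mathbb Z$. Put $$\delta_{jk}=\frac1{\sqrt{a_j}}\int_{\mathbb R}\psi\Big(\frac{t-b_{jk}}{a_j}\Big)X(t)\,dt,\qquad \delta_j^{(2,m_j)}=\sum_{k=1}^{m_j}\delta_{jk}^2 .$$ Assume that $$\lim_{j\to+\infty}\frac{a_j\log(m_j)}{\gamma_j\,m_j^{1/2}}=0 .$$ Then the integrals defining the $\delta_{jk}$ converge absolutely almost surely, every $\delta_j^{(2,m_j)}$ is square integrable, $\mathrm{Var}(\delta_j^{(2,m_j)})>0$ for all large enough $j$, and, as $j\to+\infty$, the random variables $$Y_j=\frac{\delta_j^{(2,m_j)}-\mathbb E\big(\delta_j^{(2,m_j)}\big)}{\sqrt{\mathrm{Var}\big(\delta_j^{(2,m_j)}\big)}}$$ converge in distribution to a standard Gaussian random variable. -/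

import Mathlib

open MeasureTheory ProbabilityTheory Filter Topology Set

noncomputable section

namespace CyclicLongMemory

/-- `X` is a (jointly) measurable, mean-square continuous, stationary, zero-mean, real-valued
Gaussian process indexed by `ℝ`. -/
structure IsStationaryGaussian {Ω : Type*} [MeasurableSpace Ω] (X : ℝ → Ω → ℝ)
    (P : Measure Ω) : Prop where
  measurable : Measurable (fun p : ℝ × Ω => X p.1 p.2)
  gaussian : IsGaussianProcess X P
  centered : ∀ t : ℝ, ∫ ω, X t ω ∂P = 0
  meanSquareContinuous :
    ∀ t : ℝ, Tendsto (fun s : ℝ => ∫ ω, (X s ω - X t ω) ^ 2 ∂P) (𝓝 t) (𝓝 0)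
  stationary : ∀ (I : Finset ℝ) (r : ℝ),
    IdentDistrib (fun (ω : Ω) (i : I) => X ((i : ℝ) + r) ω) (fun (ω : Ω) (i : I) => X (i : ℝ) ω) P P

/-- The finite measure `F` is the spectral measure of `X`:
`Cov(X(t), X(t')) = ∫ exp(i u (t - t')) F(du)`. -/
structure IsSpectralMeasure {Ω : Type*} [MeasurableSpace Ω] (X : ℝ → Ω → ℝ)
    (P : Measure Ω) (F : Measure ℝ) : Prop where
  finite : IsFiniteMeasure F
  covariance_eq : ∀ t t' : ℝ,
    ((covariance (X t) (X t') P : ℝ) : ℂ) =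
      ∫ u : ℝ, Complex.exp (Complex.I * ((u * (t - t') : ℝ) : ℂ)) ∂F

/-- `X` has an absolutely continuous spectrum with spectral density `f`: the function `f` is
non-negative and integrable, and `f(u) du` is the spectral measure of `X`. -/
structure IsSpectralDensity {Ω : Type*} [MeasurableSpace Ω] (X : ℝ → Ω → ℝ)
    (P : Measure Ω) (f : ℝ → ℝ) : Prop where
  nonneg : ∀ u : ℝ, 0 ≤ f u
  integrable : Integrable f
  isSpectralMeasure : IsSpectralMeasure X P (volume.withDensity fun u => ENNReal.ofReal (f u))

/-- `f(u) = h(u) / |u² - s₀²|^{2α}`; the values at the two singular points `u = ± s₀` are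
irrelevant, since `f` is only used as a density. -/
def cyclicDensity (s₀ α : ℝ) (h : ℝ → ℝ) (u : ℝ) : ℝ :=
  h u / |u ^ 2 - s₀ ^ 2| ^ (2 * α)

/-- The conditions on the parameters `s₀`, `α` and on the function `h` in the semiparametric
model `f(u) = h(u) / |u² - s₀²|^{2α}`. -/
structure IsCyclicModel (s₀ α : ℝ) (h : ℝ → ℝ) : Prop where
  one_lt_s₀ : 1 < s₀
  α_mem : α ∈ Ioo (0 : ℝ) (1 / 2)
  even : ∀ u : ℝ, h (-u) = h u
  nonneg : ∀ u : ℝ, 0 ≤ h u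
  bounded : ∃ C : ℝ, ∀ u : ℝ, h u ≤ C
  contDiff : ContDiff ℝ 4 h
  iteratedDeriv_zero : ∀ i ∈ Finset.Icc 1 4, iteratedDeriv i h 0 = 0
  h_zero : h 0 = 1
  pos_near : ∀ᶠ u in 𝓝 s₀, 0 < h u
  pos_near_neg : ∀ᶠ u in 𝓝 (-s₀), 0 < h u
  integrable_div : ∀ ε : ℝ, 0 < ε → Integrable (fun u : ℝ => h u / (1 + |u|) ^ ε)

/-- The Fourier transform `ψ̂(u) = ∫ exp(-i u t) ψ(t) dt`. -/
def fourierHat (ψ : ℝ → ℝ) (u : ℝ) : ℂ :=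
  ∫ t : ℝ, Complex.exp (-(Complex.I * ((u * t : ℝ) : ℂ))) * (ψ t : ℂ)

/-- The conditions on the filter `ψ`: it is in `L₁(ℝ)`, not (a.e.) zero, its Fourier transform is
supported in `[-A, A]` and has bounded variation there. -/
structure IsFilter (A : ℝ) (ψ : ℝ → ℝ) : Prop where
  A_pos : 0 < A
  integrable : Integrable ψ
  nonzero : ¬ (ψ =ᵐ[volume] fun _ => (0 : ℝ))
  support_subset : tsupport (fourierHat ψ) ⊆ Icc (-A) A
  boundedVariation : BoundedVariationOn (fourierHat ψ) (Icc (-A) A)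

/-- The filter transform at scale `a` and shift `b`:
`a^{-1/2} ∫ ψ((t - b) / a) X(t) dt` (pathwise integral). -/
def filterTransform {Ω : Type*} (ψ : ℝ → ℝ) (X : ℝ → Ω → ℝ) (a b : ℝ) (ω : Ω) : ℝ :=
  (1 / Real.sqrt a) * ∫ t : ℝ, ψ ((t - b) / a) * X t ω

/-- The filter coefficients `δ_{jk}`. -/
def filterCoeff {Ω : Type*} (ψ : ℝ → ℝ) (X : ℝ → Ω → ℝ) (a : ℕ → ℝ) (b : ℕ → ℤ → ℝ)
    (j : ℕ) (k : ℤ) (ω : Ω) : ℝ :=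
  filterTransform ψ X (a j) (b j k) ω

/-- `δ_j^{(2, m_j)} = ∑_{k=1}^{m_j} δ_{jk}²`. -/
def sumSqCoeff {Ω : Type*} (ψ : ℝ → ℝ) (X : ℝ → Ω → ℝ) (a : ℕ → ℝ) (b : ℕ → ℤ → ℝ)
    (m : ℕ → ℕ) (j : ℕ) (ω : Ω) : ℝ :=
  ∑ k ∈ Finset.Icc 1 (m j), filterCoeff ψ X a b j (k : ℤ) ω ^ 2

/-- `(S - E S) / √(Var S)`. -/
def standardize {Ω : Type*} [MeasurableSpace Ω] (S : Ω → ℝ) (P : Measure Ω) (ω : Ω) : ℝ :=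
  (S ω - ∫ ω', S ω' ∂P) / Real.sqrt (variance S P)

end CyclicLongMemory

end

/-!
The coefficients `δ_{jk}`, `1 ≤ k ≤ m_j`, form a centered Gaussian vector. Indeed `∫ φ(t) X(t) dt`,
for `φ ∈ L¹`, is a Bochner integral of the continuous `L²`-valued curve `t ↦ X(t)`, so it belongs
to the closed linear span of the process, all of whose elements are Gaussian
(`hasGaussianLaw_of_mem_gaussianSpace`, `IsStationaryGaussian.coeFn_integralL2`). Passing to the
spectral domain, the covariance of `δ_{jk}` and `δ_{jl}` is the Fourier integral of
`|ψ̂(v)|² f(v / a_j)` at the frequency `(b_{jk} - b_{jl}) / a_j` (`inner_integralL2_filterKernel`).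

For large `j` only the values of the spectral density near `0` enter, where it is Lipschitz and
bounded away from `0`; the singularities at `± s₀` play no role. Hence the variances lie between two
positive constants. Since `ψ̂` has bounded variation and vanishes at `± A`, translating the
integrand by `d` moves it by `O(d)` in `L¹`, and a translation by half a period of the exponential
bounds the covariances by a multiple of `a_j / |b_{jk} - b_{jl}| ≤ a_j / (γ_j |k - l|)`
(`exists_covariance_bounds`).

Rotating the vector to principal axes, `∑ δ_{jk}²` becomes `∑ η_i²` with independent centered
Gaussian `η_i`, whose variances `d_i` are the eigenvalues of the covariance matrix
(`exists_independent_coordinates`). After standardization this is a sum of independent normalized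
chi-squared variables with weights `d_i / (∑ d_i²)^{1/2}`, which is asymptotically Gaussian when the
largest weight tends to `0`; this follows from a second order expansion of the characteristic
function (`tendsto_prod_charFun_chiSqLaw`). The largest eigenvalue is at most the maximal absolute
row sum, which is `O(1 + (a_j / γ_j) log m_j)` by comparison with a harmonic sum, while `∑ d_i²`,
the squared Hilbert-Schmidt norm, is at least a multiple of `m_j` because of the diagonal. As
`a_j log m_j / (γ_j m_j^{1/2})` tends to `0`, so does the largest weight.
-/

namespace CyclicLongMemory

noncomputable section

/-! ### Gaussian subspaces of `L²` -/

section GaussianSpace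

lemma integral_sq_eq_norm_sq {Ω : Type*} [MeasurableSpace Ω] {P : Measure Ω} (Y : Lp ℝ 2 P) :
    ∫ ω, (Y ω) ^ 2 ∂P = ‖Y‖ ^ 2 := by
  rw [← real_inner_self_eq_norm_sq, L2.inner_def]
  congr 1 with ω
  simp [sq]

variable {Ω : Type*} [MeasurableSpace Ω] {P : Measure Ω} [IsProbabilityMeasure P]

lemma integral_abs_le_norm (Y : Lp ℝ 2 P) : ∫ ω, |Y ω| ∂P ≤ ‖Y‖ := by
  have h2 : MemLp (fun ω => |Y ω|) 2 P := (Lp.memLp Y).norm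
  have h := variance_eq_sub h2
  have hv := variance_nonneg (fun ω => |Y ω|) P
  have : (∫ ω, |Y ω| ∂P) ^ 2 ≤ ‖Y‖ ^ 2 := by
    rw [← integral_sq_eq_norm_sq]
    have e : ∫ ω, ((fun ω => |Y ω|) ^ 2) ω ∂P = ∫ ω, (Y ω) ^ 2 ∂P := by simp
    rw [← e]
    linarith
  exact abs_le_of_sq_le_sq' this (norm_nonneg _) |>.2

/-- The characteristic function of an element of `L²`, at a fixed point, is continuous on `L²`. -/
lemma continuous_integral_exp_mul_I (t : ℝ) :
    Continuous (fun Y : Lp ℝ 2 P => ∫ ω, Complex.exp ((t * Y ω : ℝ) * Complex.I) ∂P) := by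
  refine LipschitzWith.continuous (K := ⟨|t|, abs_nonneg t⟩) ?_
  refine LipschitzWith.of_dist_le_mul fun Y Z => ?_
  have hint : ∀ Y : Lp ℝ 2 P,
      Integrable (fun ω => Complex.exp ((t * Y ω : ℝ) * Complex.I)) P := by
    intro Y
    refine Integrable.of_bound (C := 1) ?_ (by filter_upwards with ω; simp [Complex.norm_exp])
    have := (Lp.aestronglyMeasurable Y).aemeasurable
    exact AEMeasurable.aestronglyMeasurable (by fun_prop)
  rw [dist_eq_norm, dist_eq_norm, ← integral_sub (hint Y) (hint Z)]
  calc _ ≤ ∫ ω, |t| * |(Y - Z : Lp ℝ 2 P) ω| ∂P := by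
        refine norm_integral_le_of_norm_le ?_ ?_
        · exact (((Lp.memLp (Y - Z)).integrable (by norm_num)).abs).const_mul _
        · filter_upwards [Lp.coeFn_sub Y Z] with ω hω
          rw [hω]
          have : Complex.exp ((t * Y ω : ℝ) * Complex.I) - Complex.exp ((t * Z ω : ℝ) * Complex.I)
              = Complex.exp ((t * Z ω : ℝ) * Complex.I) *
                (Complex.exp (Complex.I * ((t * (Y ω - Z ω) : ℝ) : ℂ)) - 1) := by
            rw [mul_sub, mul_one, ← Complex.exp_add]
            push_cast
            ring_nf
          rw [this, norm_mul, Complex.norm_exp_ofReal_mul_I, one_mul, ← abs_mul]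
          exact Real.norm_exp_I_mul_ofReal_sub_one_le
    _ = |t| * ∫ ω, |(Y - Z : Lp ℝ 2 P) ω| ∂P := integral_const_mul _ _
    _ ≤ |t| * ‖Y - Z‖ := by
        gcongr
        exact integral_abs_le_norm _

/-- The closed linear span in `L²` of a family of square integrable random variables. -/
def gaussianSpace {T : Type*} (ξ : T → Lp ℝ 2 P) : Submodule ℝ (Lp ℝ 2 P) :=
  (Submodule.span ℝ (range ξ)).topologicalClosure

/-- For finite linear combinations this is the Gaussian property of the process; prescribing the
value of the characteristic function in terms of the norm is a closed condition on `L²`. -/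
lemma map_eq_gaussianReal_of_mem_gaussianSpace {T : Type*} {X : T → Ω → ℝ}
    (hX : IsGaussianProcess X P) (h0 : ∀ t, ∫ ω, X t ω ∂P = 0) {ξ : T → Lp ℝ 2 P}
    (hξ : ∀ t, ξ t =ᵐ[P] X t) {Y : Lp ℝ 2 P} (hY : Y ∈ gaussianSpace ξ) :
    P.map Y = gaussianReal 0 (‖Y‖ ^ 2).toNNReal := by
  classical
  have hspan : ∀ Y ∈ Submodule.span ℝ (range ξ), ∀ t : ℝ,
      ∫ ω, Complex.exp ((t * Y ω : ℝ) * Complex.I) ∂P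
        = Complex.exp (-((‖Y‖ ^ 2 * t ^ 2 / 2 : ℝ) : ℂ)) := by
    intro Y hY t
    obtain ⟨c, rfl⟩ := Finsupp.mem_span_range_iff_exists_finsupp.1 hY
    set Y : Lp ℝ 2 P := c.sum fun i a => a • ξ i with hYdef
    have hae : (Y : Ω → ℝ) =ᵐ[P] fun ω => ∑ i ∈ c.support, c i * X i ω := by
      have h1 : (Y : Ω → ℝ) =ᵐ[P] ∑ i ∈ c.support, ((c i • ξ i : Lp ℝ 2 P) : Ω → ℝ) := by
        rw [hYdef, Finsupp.sum]
        exact Lp.coeFn_finsetSum _ _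
      refine h1.trans ?_
      have h2 : ∀ᵐ ω ∂P, ∀ i ∈ c.support, (c i • ξ i : Lp ℝ 2 P) ω = c i * X i ω := by
        rw [eventually_all_finset]
        intro i _
        filter_upwards [Lp.coeFn_smul (c i) (ξ i), hξ i] with ω h3 h4
        rw [h3, Pi.smul_apply, h4, smul_eq_mul]
      filter_upwards [h2] with ω h
      rw [Finset.sum_apply]
      exact Finset.sum_congr rfl h
    let L : (c.support → ℝ) →L[ℝ] ℝ :=
      ∑ i : c.support, c (i : T) • ContinuousLinearMap.proj (R := ℝ) (φ := fun _ => ℝ) i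
    have hL : (fun ω => L (c.support.restrict (X · ω))) =
        fun ω => ∑ i ∈ c.support, c i * X i ω := by
      ext ω
      simp only [L, sum_apply, smul_apply,
        ContinuousLinearMap.proj_apply, Finset.restrict, smul_eq_mul]
      exact Finset.sum_coe_sort c.support (fun i => c i * X i ω)
    have hG : HasGaussianLaw (Y : Ω → ℝ) P := by
      have := (hX.hasGaussianLaw c.support).map_fun L
      rw [hL] at this
      exact this.congr hae.symm
    have hm : ∫ ω, Y ω ∂P = 0 := by
      rw [integral_congr_ae hae, integral_finsetSum]
      · simp [integral_const_mul, h0]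
      · intro i _
        exact ((hX.hasGaussianLaw_eval i).integrable).const_mul _
    have hv : Var[Y; P] = ‖Y‖ ^ 2 := by
      rw [variance_of_integral_eq_zero hG.aemeasurable hm]
      exact integral_sq_eq_norm_sq Y
    have hmap := hG.map_eq_gaussianReal
    rw [hm, hv] at hmap
    have hc := charFun_gaussianReal (μ := 0) (v := (‖Y‖ ^ 2).toNNReal) t
    rw [← hmap, charFun_apply_real, integral_map hG.aemeasurable
      (by fun_prop)] at hc
    rw [Real.coe_toNNReal _ (sq_nonneg _)] at hc
    convert! hc using 2
    · push_cast; ring_nf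
    · push_cast; ring_nf
  have hcl : ∀ Y ∈ gaussianSpace ξ, ∀ t : ℝ,
      ∫ ω, Complex.exp ((t * Y ω : ℝ) * Complex.I) ∂P
        = Complex.exp (-((‖Y‖ ^ 2 * t ^ 2 / 2 : ℝ) : ℂ)) := by
    intro Y hY t
    have hclosed : IsClosed {Y : Lp ℝ 2 P | ∫ ω, Complex.exp ((t * Y ω : ℝ) * Complex.I) ∂P
        = Complex.exp (-((‖Y‖ ^ 2 * t ^ 2 / 2 : ℝ) : ℂ))} :=
      isClosed_eq (continuous_integral_exp_mul_I t) (by fun_prop)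
    exact closure_minimal (fun Z hZ => hspan Z hZ t) hclosed hY
  have hYm := (Lp.aestronglyMeasurable Y).aemeasurable
  have : IsProbabilityMeasure (P.map Y) := Measure.isProbabilityMeasure_map hYm
  refine Measure.ext_of_charFun ?_
  ext t
  rw [charFun_gaussianReal, charFun_apply_real, integral_map hYm (by fun_prop),
    Real.coe_toNNReal _ (sq_nonneg _)]
  convert! hcl Y hY t using 2
  · congr 1 with ω
    push_cast
    ring_nf
  · push_cast; ring_nf

/-- Finitely many elements of a Gaussian space are jointly Gaussian. -/
lemma hasGaussianLaw_of_mem_gaussianSpace {T : Type*} {X : T → Ω → ℝ}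
    (hX : IsGaussianProcess X P) (h0 : ∀ t, ∫ ω, X t ω ∂P = 0) {ξ : T → Lp ℝ 2 P}
    (hξ : ∀ t, ξ t =ᵐ[P] X t) {ι : Type*} [Fintype ι] {Y : ι → Lp ℝ 2 P}
    (hY : ∀ i, Y i ∈ gaussianSpace ξ) :
    HasGaussianLaw (fun ω i => Y i ω) P := by
  classical
  have hm : AEMeasurable (fun ω i => Y i ω) P :=
    aemeasurable_pi_lambda _ fun i => (Lp.aestronglyMeasurable (Y i)).aemeasurable
  refine ⟨⟨fun L => ?_⟩⟩
  set Z : Lp ℝ 2 P := ∑ i, L (Pi.single i 1) • Y i with hZ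
  have hZmem : Z ∈ gaussianSpace ξ :=
    Submodule.sum_mem _ fun i _ => Submodule.smul_mem _ _ (hY i)
  have hae : (fun ω => L (fun i => Y i ω)) =ᵐ[P] Z := by
    have h1 : (Z : Ω → ℝ) =ᵐ[P]
        ∑ i, ((L (Pi.single i 1) • Y i : Lp ℝ 2 P) : Ω → ℝ) := Lp.coeFn_finsetSum _ _
    have h2 : ∀ᵐ ω ∂P, ∀ i, (L (Pi.single i 1) • Y i : Lp ℝ 2 P) ω
        = L (Pi.single i 1) * Y i ω := by
      rw [ae_all_iff]
      intro i
      filter_upwards [Lp.coeFn_smul (L (Pi.single i 1)) (Y i)] with ω h3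
      rw [h3, Pi.smul_apply, smul_eq_mul]
    filter_upwards [h1, h2] with ω h3 h4
    rw [h3, Finset.sum_apply, Finset.sum_congr rfl fun i _ => h4 i]
    conv_lhs => rw [show (fun i => Y i ω) = ∑ i, (Y i ω) • Pi.single i (1 : ℝ) from
      (pi_eq_sum_univ' _), map_sum]
    refine Finset.sum_congr rfl fun i _ => ?_
    rw [map_smul, smul_eq_mul, mul_comm]
  have hmap : (P.map (fun ω i => Y i ω)).map L = gaussianReal 0 (‖Z‖ ^ 2).toNNReal := by
    rw [AEMeasurable.map_map_of_aemeasurable (by fun_prop) hm,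
      ← map_eq_gaussianReal_of_mem_gaussianSpace hX h0 hξ hZmem]
    exact Measure.map_congr hae
  have hLm : AEMeasurable L (P.map (fun ω i => Y i ω)) := by fun_prop
  have e1 : ∫ x, L x ∂(P.map (fun ω i => Y i ω)) = 0 := by
    have := integral_map hLm (f := fun x : ℝ => x) (by fun_prop)
    rw [← this, hmap, integral_id_gaussianReal]
  have e2 : Var[L; P.map (fun ω i => Y i ω)] = ‖Z‖ ^ 2 := by
    have := variance_map (X := fun x : ℝ => x) (Y := L) (by fun_prop) hLm
    have h2 := variance_id_gaussianReal (μ := 0) (v := (‖Z‖ ^ 2).toNNReal)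
    rw [Real.coe_toNNReal _ (sq_nonneg _), ← hmap] at h2
    rw [← h2]
    exact this.symm
  rw [hmap]
  congr 1
  · exact e1.symm
  · rw [e2]

end GaussianSpace

/-! ### Linear functionals of the process -/

lemma norm_fourierHat_le {χ : ℝ → ℝ} (hχ : Integrable χ) (u : ℝ) :
    ‖fourierHat χ u‖ ≤ ∫ t, |χ t| := by
  refine norm_integral_le_of_norm_le hχ.abs ?_
  filter_upwards with t
  rw [norm_mul, ← mul_neg, ← Complex.ofReal_neg, Complex.norm_exp_I_mul_ofReal]
  simp

lemma continuous_fourierHat {χ : ℝ → ℝ} (hχ : Integrable χ) : Continuous (fourierHat χ) := by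
  refine continuous_of_dominated (bound := fun t => |χ t|) ?_ ?_ hχ.abs ?_
  · intro u
    exact (Continuous.aestronglyMeasurable (by fun_prop)).mul hχ.ofReal.aestronglyMeasurable
  · intro u
    filter_upwards with t
    rw [norm_mul, ← mul_neg, ← Complex.ofReal_neg, Complex.norm_exp_I_mul_ofReal]
    simp
  · filter_upwards with t
    fun_prop

section Functional

variable {Ω : Type*} [MeasurableSpace Ω] {P : Measure Ω} {X : ℝ → Ω → ℝ}

lemma IsStationaryGaussian.memLp (hX : IsStationaryGaussian X P) (t : ℝ) : MemLp (X t) 2 P :=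
  (hX.gaussian.hasGaussianLaw_eval t).memLp_two

/-- The process seen as a curve in `L²`. -/
def IsStationaryGaussian.toL2 (hX : IsStationaryGaussian X P) (t : ℝ) : Lp ℝ 2 P :=
  (hX.memLp t).toLp (X t)

lemma IsStationaryGaussian.coeFn_toL2 (hX : IsStationaryGaussian X P) (t : ℝ) :
    hX.toL2 t =ᵐ[P] X t := (hX.memLp t).coeFn_toLp

lemma IsStationaryGaussian.continuous_toL2 (hX : IsStationaryGaussian X P) :
    Continuous hX.toL2 := by
  rw [continuous_iff_continuousAt]
  intro t
  rw [ContinuousAt, tendsto_iff_norm_sub_tendsto_zero]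
  have h : ∀ s, ‖hX.toL2 s - hX.toL2 t‖ = √(∫ ω, (X s ω - X t ω) ^ 2 ∂P) := by
    intro s
    rw [← Real.sqrt_sq (norm_nonneg (hX.toL2 s - hX.toL2 t)), ← integral_sq_eq_norm_sq]
    congr 1
    refine integral_congr_ae ?_
    filter_upwards [Lp.coeFn_sub (hX.toL2 s) (hX.toL2 t), hX.coeFn_toL2 s, hX.coeFn_toL2 t]
      with ω h1 h2 h3
    rw [h1, Pi.sub_apply, h2, h3]
  simp_rw [h]
  simpa using (hX.meanSquareContinuous t).sqrt

variable [IsProbabilityMeasure P]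

lemma IsStationaryGaussian.inner_toL2 (hX : IsStationaryGaussian X P) (s t : ℝ) :
    inner ℝ (hX.toL2 s) (hX.toL2 t) = cov[X s, X t; P] := by
  rw [covariance_eq_sub (hX.memLp s) (hX.memLp t), hX.centered s, hX.centered t, L2.inner_def]
  simp only [mul_zero, sub_zero]
  refine integral_congr_ae ?_
  filter_upwards [hX.coeFn_toL2 s, hX.coeFn_toL2 t] with ω h1 h2
  simp [h1, h2, mul_comm]

variable {F : Measure ℝ}

lemma IsStationaryGaussian.norm_toL2_sq (hX : IsStationaryGaussian X P)
    (hF : IsSpectralMeasure X P F) (t : ℝ) : ‖hX.toL2 t‖ ^ 2 = F.real univ := by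
  have h := hF.covariance_eq t t
  simp only [sub_self, mul_zero, Complex.ofReal_zero, Complex.exp_zero, integral_const,
    Complex.real_smul, mul_one] at h
  rw [← real_inner_self_eq_norm_sq, hX.inner_toL2]
  exact_mod_cast h

lemma IsStationaryGaussian.norm_toL2 (hX : IsStationaryGaussian X P)
    (hF : IsSpectralMeasure X P F) (t : ℝ) : ‖hX.toL2 t‖ = √(F.real univ) := by
  rw [← hX.norm_toL2_sq hF t, Real.sqrt_sq (norm_nonneg _)]

lemma IsStationaryGaussian.integral_abs_le (hX : IsStationaryGaussian X P)
    (hF : IsSpectralMeasure X P F) (t : ℝ) : ∫ ω, |X t ω| ∂P ≤ √(F.real univ) := by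
  rw [← hX.norm_toL2 hF t]
  refine le_trans (le_of_eq ?_) (integral_abs_le_norm (hX.toL2 t))
  refine integral_congr_ae ?_
  filter_upwards [hX.coeFn_toL2 t] with ω h
  rw [h]

lemma IsStationaryGaussian.integrable_smul_toL2 (hX : IsStationaryGaussian X P)
    (hF : IsSpectralMeasure X P F) {φ : ℝ → ℝ} (hφ : Integrable φ) :
    Integrable (fun t => φ t • hX.toL2 t) := by
  refine Integrable.mono' (hφ.norm.mul_const √(F.real univ))
    (hφ.aestronglyMeasurable.smul hX.continuous_toL2.aestronglyMeasurable) ?_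
  filter_upwards with t
  rw [norm_smul, hX.norm_toL2 hF]

lemma IsStationaryGaussian.integrable_prod (hX : IsStationaryGaussian X P)
    (hF : IsSpectralMeasure X P F) {φ : ℝ → ℝ} (hφ : Integrable φ) :
    Integrable (fun p : ℝ × Ω => φ p.1 * X p.1 p.2) (volume.prod P) := by
  have hm : AEStronglyMeasurable (fun p : ℝ × Ω => φ p.1 * X p.1 p.2) (volume.prod P) :=
    hφ.aestronglyMeasurable.comp_fst.mul hX.measurable.aestronglyMeasurable
  rw [integrable_prod_iff hm]
  refine ⟨?_, ?_⟩
  · filter_upwards with t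
    exact ((hX.memLp t).integrable (by norm_num)).const_mul _
  · refine Integrable.mono' (hφ.norm.mul_const √(F.real univ))
      hm.norm.integral_prod_right' ?_
    filter_upwards with t
    rw [Real.norm_of_nonneg (integral_nonneg fun _ => norm_nonneg _)]
    simp_rw [norm_mul, integral_const_mul]
    gcongr
    exact hX.integral_abs_le hF t

/-- The functional `∫ φ(t) X(t) dt` as a Bochner integral in `L²`. -/
def IsStationaryGaussian.integralL2 (hX : IsStationaryGaussian X P) (φ : ℝ → ℝ) : Lp ℝ 2 P :=
  ∫ t, φ t • hX.toL2 t

lemma IsStationaryGaussian.integralL2_mem (hX : IsStationaryGaussian X P)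
    (hF : IsSpectralMeasure X P F) {φ : ℝ → ℝ} (hφ : Integrable φ) :
    hX.integralL2 φ ∈ gaussianSpace hX.toL2 := by
  set H := gaussianSpace hX.toL2
  have hH : IsClosed (H : Set (Lp ℝ 2 P)) := Submodule.isClosed_topologicalClosure _
  have : CompleteSpace H := hH.completeSpace_coe
  have hint := hX.integrable_smul_toL2 hF hφ
  have hmem : ∀ t, φ t • hX.toL2 t ∈ H := fun t =>
    H.smul_mem _ (Submodule.le_topologicalClosure _ (Submodule.subset_span ⟨t, rfl⟩))
  -- the orthogonal projection onto `H` commutes with the integral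
  have hproj := H.starProjection.integral_comp_comm hint
  have : ∀ t, H.starProjection (φ t • hX.toL2 t) = φ t • hX.toL2 t := fun t =>
    Submodule.starProjection_eq_self_iff.2 (hmem t)
  simp_rw [this] at hproj
  exact Submodule.starProjection_eq_self_iff.1 hproj.symm

/-- The Bochner integral in `L²` is represented by the pathwise integral. -/
lemma IsStationaryGaussian.coeFn_integralL2 (hX : IsStationaryGaussian X P)
    (hF : IsSpectralMeasure X P F) {φ : ℝ → ℝ} (hφ : Integrable φ) :
    hX.integralL2 φ =ᵐ[P] fun ω => ∫ t, φ t * X t ω := by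
  have hprod := hX.integrable_prod hF hφ
  refine Integrable.ae_eq_of_forall_setIntegral_eq _ _
    ((Lp.memLp _).integrable (by norm_num)) hprod.integral_prod_right ?_
  intro s hs _
  have hms : P s ≠ ⊤ := measure_ne_top _ _
  have h1 : ∀ Y : Lp ℝ 2 P, ∫ ω in s, Y ω ∂P = inner ℝ (indicatorConstLp 2 hs hms (1 : ℝ)) Y :=
    fun Y => (L2.inner_indicatorConstLp_one hs hms Y).symm
  have hsw : ∫ ω in s, (∫ t : ℝ, φ t * X t ω) ∂P = ∫ t : ℝ, (∫ ω in s, φ t * X t ω ∂P) := by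
    refine integral_integral_swap (f := fun ω t => φ t * X t ω) ?_
    have := hprod.swap
    refine Integrable.mono_measure (ν := P.prod volume) this ?_
    exact Measure.prod_mono Measure.restrict_le_self le_rfl
  rw [hsw, h1, IsStationaryGaussian.integralL2, ← integral_inner (hX.integrable_smul_toL2 hF hφ)]
  refine integral_congr_ae ?_
  filter_upwards with t
  rw [inner_smul_right, ← h1, integral_const_mul]
  congr 1
  exact setIntegral_congr_ae hs ((hX.coeFn_toL2 t).mono fun ω h _ => h)

/-- Isometry between functionals of the process and the spectral domain: the covariance of
`∫ φ(t) X(t) dt` and `∫ χ(t) X(t) dt` is the `L²(F)` inner product of the Fourier transforms. -/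
lemma IsStationaryGaussian.inner_integralL2 (hX : IsStationaryGaussian X P)
    (hF : IsSpectralMeasure X P F) {φ χ : ℝ → ℝ} (hφ : Integrable φ) (hχ : Integrable χ) :
    ((inner ℝ (hX.integralL2 φ) (hX.integralL2 χ) : ℝ) : ℂ)
      = ∫ u, (starRingEnd ℂ) (fourierHat φ u) * fourierHat χ u ∂F := by
  have := hF.finite
  have hiφ := hX.integrable_smul_toL2 hF hφ
  have hiχ := hX.integrable_smul_toL2 hF hχ
  have e1 : inner ℝ (hX.integralL2 φ) (hX.integralL2 χ)
      = ∫ t, φ t * ∫ s, χ s * cov[X t, X s; P] := by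
    rw [real_inner_comm]
    conv_lhs => rw [IsStationaryGaussian.integralL2.eq_def hX φ]
    rw [← integral_inner hiφ]
    refine integral_congr_ae ?_
    filter_upwards with t
    rw [inner_smul_right, real_inner_comm, IsStationaryGaussian.integralL2, ← integral_inner hiχ]
    congr 1
    refine integral_congr_ae ?_
    filter_upwards with s
    rw [inner_smul_right, hX.inner_toL2]
  have hexp : Continuous fun p : ℝ × ℝ => Complex.exp (-(Complex.I * ((p.2 * p.1 : ℝ) : ℂ))) := by
    fun_prop
  have hexp' : Continuous fun p : ℝ × ℝ => Complex.exp (Complex.I * ((p.2 * p.1 : ℝ) : ℂ)) := by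
    fun_prop
  have hhat := continuous_fourierHat hχ
  have e2 : ∀ t, ((∫ s, χ s * cov[X t, X s; P] : ℝ) : ℂ)
      = ∫ u, Complex.exp (Complex.I * ((u * t : ℝ) : ℂ)) * fourierHat χ u ∂F := by
    intro t
    rw [← integral_complex_ofReal]
    have : ∀ s, ((χ s * cov[X t, X s; P] : ℝ) : ℂ) =
        ∫ u, Complex.exp (Complex.I * ((u * t : ℝ) : ℂ)) *
          (Complex.exp (-(Complex.I * ((u * s : ℝ) : ℂ))) * (χ s : ℂ)) ∂F := by
      intro s
      rw [Complex.ofReal_mul, hF.covariance_eq, ← integral_const_mul]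
      congr 1 with u
      rw [mul_comm, ← mul_assoc, ← Complex.exp_add]
      congr 2
      push_cast
      ring
    simp_rw [this, fourierHat]
    rw [integral_integral_swap]
    · simp_rw [integral_const_mul]
    · refine Integrable.mono' (g := fun p : ℝ × ℝ => |χ p.1|) (hχ.abs.comp_fst F) ?_ ?_
      · refine AEStronglyMeasurable.mul (Continuous.aestronglyMeasurable (by fun_prop)) ?_
        exact hexp.aestronglyMeasurable.mul hχ.ofReal.aestronglyMeasurable.comp_fst
      · filter_upwards with p
        rw [Function.uncurry, norm_mul, norm_mul, ← mul_neg, ← Complex.ofReal_neg,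
          Complex.norm_exp_I_mul_ofReal, Complex.norm_exp_I_mul_ofReal]
        simp
  have e3 : ∀ u, (starRingEnd ℂ) (fourierHat φ u) =
      ∫ t, Complex.exp (Complex.I * ((u * t : ℝ) : ℂ)) * (φ t : ℂ) := by
    intro u
    rw [fourierHat, ← integral_conj]
    congr 1 with t
    rw [map_mul, ← Complex.exp_conj]
    simp
  rw [e1, ← integral_complex_ofReal]
  simp_rw [Complex.ofReal_mul, e2, e3, ← integral_const_mul, ← integral_mul_const]
  rw [integral_integral_swap]
  · congr 1 with u
    congr 1 with t
    ring
  · refine Integrable.mono' (g := fun p : ℝ × ℝ => |φ p.1| * ∫ t, |χ t|)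
      ((hφ.abs.mul_const _).comp_fst F) ?_ ?_
    · refine AEStronglyMeasurable.mul hφ.ofReal.aestronglyMeasurable.comp_fst ?_
      exact hexp'.aestronglyMeasurable.mul (Continuous.aestronglyMeasurable (by fun_prop))
    · filter_upwards with p
      rw [Function.uncurry, norm_mul, norm_mul, Complex.norm_exp_I_mul_ofReal, one_mul]
      simpa using mul_le_mul_of_nonneg_left (norm_fourierHat_le hχ p.2) (abs_nonneg _)

end Functional

/-! ### Decay of Fourier integrals of functions of bounded variation -/

/-- A function of bounded variation is Lipschitz in the mean: translating by `d` moves it by at most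
a constant times `d` in `L¹`. -/
lemma exists_integral_norm_translate_sub_le {G : ℝ → ℂ} (hG : Integrable G)
    (hV : BoundedVariationOn G univ) :
    ∃ V : ℝ, ∀ d : ℝ, 0 ≤ d → ∫ v, ‖G (v + d) - G v‖ ≤ d * V := by
  set W : ℝ → ℝ := variationOnFromTo G univ 0 with hW
  have hloc := hV.locallyBoundedVariationOn
  have hmono : Monotone W := monotoneOn_univ.1 (variationOnFromTo.monotoneOn hloc (mem_univ 0))
  set C : ℝ := (eVariationOn G univ).toReal
  have hbound : ∀ x, |W x| ≤ C := by
    intro x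
    have hle : ∀ a b, (eVariationOn G (univ ∩ Icc a b)).toReal ≤ C := fun a b =>
      ENNReal.toReal_mono hV (eVariationOn.mono _ (subset_univ _))
    rcases le_total 0 x with h | h
    · rw [hW, variationOnFromTo.eq_of_le _ _ h, abs_of_nonneg ENNReal.toReal_nonneg]
      exact hle _ _
    · rw [hW, variationOnFromTo.eq_of_ge _ _ h, abs_neg, abs_of_nonneg ENNReal.toReal_nonneg]
      exact hle _ _
  have hinc : ∀ x y, x ≤ y → ‖G y - G x‖ ≤ W y - W x := by
    intro x y hxy
    have h1 : W x + variationOnFromTo G univ x y = W y :=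
      variationOnFromTo.add hloc (mem_univ _) (mem_univ _) (mem_univ _)
    have h2 : ‖G y - G x‖ ≤ variationOnFromTo G univ x y := by
      rw [variationOnFromTo.eq_of_le _ _ hxy, ← dist_eq_norm, dist_edist]
      refine ENNReal.toReal_mono (hloc x y (mem_univ _) (mem_univ _)) ?_
      exact eVariationOn.edist_le _ ⟨mem_univ _, hxy, le_rfl⟩ ⟨mem_univ _, le_rfl, hxy⟩
    linarith
  refine ⟨2 * C, fun d hd => ?_⟩
  have hint : Integrable (fun v => ‖G (v + d) - G v‖) := ((hG.comp_add_right d).sub hG).norm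
  have hWi : ∀ a b, IntervalIntegrable W volume a b := fun a b => hmono.intervalIntegrable
  -- on a bounded interval the integral of the increment of the variation function telescopes
  have hfin : ∀ N : ℕ, ∫ v in (-(N : ℝ))..N, ‖G (v + d) - G v‖ ≤ d * (2 * C) := by
    intro N
    have hN : -(N : ℝ) ≤ N := by linarith [Nat.cast_nonneg (α := ℝ) N]
    have hWd : ∀ a b, IntervalIntegrable (fun v => W (v + d)) volume a b := fun a b =>
      (hmono.comp (fun x y h => by simpa using h : Monotone fun v : ℝ => v + d)).intervalIntegrable
    calc _ ≤ ∫ v in (-(N : ℝ))..N, (W (v + d) - W v) :=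
          intervalIntegral.integral_mono_on hN hint.intervalIntegrable
            ((hWd _ _).sub (hWi _ _)) fun v _ => hinc _ _ (by linarith)
      _ = (∫ v in (N : ℝ)..(N + d), W v) - ∫ v in (-(N : ℝ))..(-N + d), W v := by
          rw [intervalIntegral.integral_sub (hWd _ _) (hWi _ _),
            intervalIntegral.integral_comp_add_right (fun v => W v) d]
          have h1 := intervalIntegral.integral_add_adjacent_intervals
            (hWi (-N + d) N) (hWi N (N + d))
          have h2 := intervalIntegral.integral_add_adjacent_intervals
            (hWi (-N) (-N + d)) (hWi (-N + d) N)
          linarith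
      _ ≤ d * C + d * C := by
          have hb : ∀ a : ℝ, |∫ v in a..(a + d), W v| ≤ d * C := by
            intro a
            have := intervalIntegral.norm_integral_le_of_norm_le_const (a := a) (b := a + d)
              (f := W) (C := C) fun x _ => hbound x
            rw [Real.norm_eq_abs, add_sub_cancel_left, abs_of_nonneg hd] at this
            linarith
          have h1 := (abs_le.1 (hb N)).2
          have h2 := (abs_le.1 (hb (-N))).1
          linarith
      _ = d * (2 * C) := by ring
  have hlim := intervalIntegral_tendsto_integral (a := fun N : ℕ => -(N : ℝ))
    (b := fun N : ℕ => (N : ℝ)) hint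
    (tendsto_neg_atTop_atBot.comp tendsto_natCast_atTop_atTop) tendsto_natCast_atTop_atTop
  exact le_of_tendsto' hlim hfin

/-- Translating by half a period `π / |τ|` changes the sign of the oscillating factor, so the
Fourier integral is controlled by the `L¹` modulus of continuity. -/
lemma norm_integral_exp_mul_le {g : ℝ → ℂ} (hg : Integrable g) {D : ℝ}
    (hD : ∀ d : ℝ, 0 ≤ d → ∫ v, ‖g (v + d) - g v‖ ≤ d * D) {τ : ℝ} (hτ : τ ≠ 0) :
    ‖∫ v, Complex.exp (Complex.I * ((v * τ : ℝ) : ℂ)) * g v‖ ≤ Real.pi * D / (2 * |τ|) := by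
  set d := Real.pi / |τ| with hd
  have hτ' : 0 < |τ| := abs_pos.2 hτ
  have hd0 : 0 ≤ d := by positivity
  have hsign : Complex.exp (Complex.I * ((d * τ : ℝ) : ℂ)) = -1 := by
    rcases lt_or_gt_of_ne hτ with h | h
    · have : d * τ = -Real.pi := by
        rw [hd, abs_of_neg h]
        field_simp
      rw [this, Complex.ofReal_neg, mul_neg, Complex.exp_neg, mul_comm, Complex.exp_pi_mul_I]
      norm_num
    · have : d * τ = Real.pi := by
        rw [hd, abs_of_pos h]
        field_simp
      rw [this, mul_comm, Complex.exp_pi_mul_I]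
  have hosc : ∀ {g : ℝ → ℂ}, Integrable g →
      Integrable (fun v => Complex.exp (Complex.I * ((v * τ : ℝ) : ℂ)) * g v) := by
    intro g hg
    refine hg.bdd_mul (c := 1) (Continuous.aestronglyMeasurable (by fun_prop)) ?_
    filter_upwards with v
    rw [Complex.norm_exp_I_mul_ofReal]
  have hshift : ∫ v, Complex.exp (Complex.I * ((v * τ : ℝ) : ℂ)) * g v
      = -∫ v, Complex.exp (Complex.I * ((v * τ : ℝ) : ℂ)) * g (v + d) := by
    rw [← integral_add_right_eq_self _ d, ← integral_neg]
    congr 1 with v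
    rw [add_mul, Complex.ofReal_add, mul_add, Complex.exp_add, hsign]
    ring
  have hdiff : 2 * ∫ v, Complex.exp (Complex.I * ((v * τ : ℝ) : ℂ)) * g v
      = -∫ v, Complex.exp (Complex.I * ((v * τ : ℝ) : ℂ)) * (g (v + d) - g v) := by
    simp_rw [mul_sub]
    rw [integral_sub (hosc (hg.comp_add_right d)) (hosc hg), two_mul]
    nth_rewrite 1 [hshift]
    ring
  have hnorm : 2 * ‖∫ v, Complex.exp (Complex.I * ((v * τ : ℝ) : ℂ)) * g v‖ ≤ d * D := by
    calc _ = ‖2 * ∫ v, Complex.exp (Complex.I * ((v * τ : ℝ) : ℂ)) * g v‖ := by simp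
      _ ≤ ∫ v, ‖g (v + d) - g v‖ := by
        rw [hdiff, norm_neg]
        refine (norm_integral_le_integral_norm _).trans (le_of_eq ?_)
        simp_rw [norm_mul, Complex.norm_exp_I_mul_ofReal, one_mul]
      _ ≤ d * D := hD d hd0
  rw [le_div_iff₀ (by positivity)]
  have : d * D * |τ| = Real.pi * D := by
    rw [hd]
    field_simp
  nlinarith

/-- The `L¹` modulus of continuity of `|G|²` times a slowly varying weight. -/
lemma integral_norm_translate_sub_sq_mul_le {G : ℝ → ℂ} (hG : Integrable G)
    {M V B K : ℝ} (hM : ∀ v, ‖G v‖ ≤ M) (hV : ∀ d : ℝ, 0 ≤ d → ∫ v, ‖G (v + d) - G v‖ ≤ d * V)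
    {w : ℝ → ℝ} (hB : ∀ v, |w v| ≤ B) (hK : ∀ x y, |w x - w y| ≤ K * |x - y|) (d : ℝ)
    (hd : 0 ≤ d) :
    ∫ v, ‖(((‖G (v + d)‖ ^ 2 * w (v + d) : ℝ) : ℂ) - ((‖G v‖ ^ 2 * w v : ℝ) : ℂ))‖
      ≤ d * (2 * M * B * V + M * K * ∫ v, ‖G v‖) := by
  have hM0 : 0 ≤ M := (norm_nonneg _).trans (hM 0)
  have hB0 : 0 ≤ B := (abs_nonneg _).trans (hB 0)
  have hK0 : 0 ≤ K := by simpa using (abs_nonneg _).trans (hK 1 0)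
  have hdG : Integrable (fun v => ‖G (v + d) - G v‖) := ((hG.comp_add_right d).sub hG).norm
  calc _ ≤ ∫ v, (2 * M * B * ‖G (v + d) - G v‖ + M * K * d * ‖G v‖) := by
        refine integral_mono_of_nonneg (Eventually.of_forall fun v => norm_nonneg _)
          ((hdG.const_mul _).add (hG.norm.const_mul _)) (Eventually.of_forall fun v => ?_)
        dsimp only
        rw [← Complex.ofReal_sub, Complex.norm_real, Real.norm_eq_abs]
        have e : ‖G (v + d)‖ ^ 2 * w (v + d) - ‖G v‖ ^ 2 * w v
            = (‖G (v + d)‖ - ‖G v‖) * (‖G (v + d)‖ + ‖G v‖) * w (v + d)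
              + ‖G v‖ * ‖G v‖ * (w (v + d) - w v) := by ring
        rw [e]
        refine (abs_add_le _ _).trans (add_le_add ?_ ?_)
        · rw [abs_mul, abs_mul]
          have h1 := abs_norm_sub_norm_le (G (v + d)) (G v)
          have h2 : |‖G (v + d)‖ + ‖G v‖| ≤ 2 * M := by
            rw [abs_of_nonneg (by positivity)]
            linarith [hM v, hM (v + d)]
          calc _ ≤ ‖G (v + d) - G v‖ * (2 * M) * B := by
                gcongr
                exact hB _
            _ = _ := by ring
        · rw [abs_mul, abs_mul, abs_norm]
          have h1 := hK (v + d) v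
          rw [add_sub_cancel_left, abs_of_nonneg hd] at h1
          calc _ ≤ M * ‖G v‖ * (K * d) := by
                gcongr
                exact hM v
            _ = _ := by ring
    _ = 2 * M * B * (∫ v, ‖G (v + d) - G v‖) + M * K * d * ∫ v, ‖G v‖ := by
        rw [integral_add (hdG.const_mul _) (hG.norm.const_mul _), integral_const_mul,
          integral_const_mul]
    _ ≤ 2 * M * B * (d * V) + M * K * d * ∫ v, ‖G v‖ := by
        gcongr
        exact hV d hd
    _ = _ := by ring

/-! ### The filter and the spectral density -/

variable {A : ℝ} {ψ : ℝ → ℝ}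

lemma IsFilter.fourierHat_eq_zero (hψ : IsFilter A ψ) {v : ℝ} (hv : A ≤ |v|) :
    fourierHat ψ v = 0 := by
  have hc := continuous_fourierHat hψ.integrable
  have hzero : ∀ v : ℝ, A < |v| → fourierHat ψ v = 0 := by
    intro v hv
    by_contra h
    have := hψ.support_subset (subset_tsupport _ (Function.mem_support.2 h))
    exact absurd (abs_le.2 this) (not_le.2 hv)
  -- the values at `± A` vanish by continuity
  have hv0 : 0 < |v| := hψ.A_pos.trans_le hv
  have hlim : Tendsto (fun s : ℝ => fourierHat ψ (s * v)) (𝓝[>] 1) (𝓝 (fourierHat ψ v)) := by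
    have : Tendsto (fun s : ℝ => fourierHat ψ (s * v)) (𝓝 1) (𝓝 (fourierHat ψ (1 * v))) :=
      Continuous.tendsto (by fun_prop) 1
    rw [one_mul] at this
    exact this.mono_left nhdsWithin_le_nhds
  refine tendsto_nhds_unique hlim (tendsto_const_nhds.congr' ?_)
  filter_upwards [self_mem_nhdsWithin] with s hs
  have hs1 : (1 : ℝ) < s := hs
  refine (hzero _ ?_).symm
  rw [abs_mul, abs_of_pos (by linarith)]
  nlinarith

lemma IsFilter.integrable_fourierHat (hψ : IsFilter A ψ) : Integrable (fourierHat ψ) := by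
  refine (continuous_fourierHat hψ.integrable).integrable_of_hasCompactSupport ?_
  exact HasCompactSupport.of_support_subset_isCompact isCompact_Icc
    ((subset_tsupport _).trans hψ.support_subset)

lemma IsFilter.boundedVariationOn_univ (hψ : IsFilter A ψ) :
    BoundedVariationOn (fourierHat ψ) univ := by
  have hA := hψ.A_pos
  -- `ψ̂` is its restriction to `[-A, A]` composed with the monotone projection onto that interval
  set c : ℝ → ℝ := fun v => max (-A) (min A v)
  have hcm : Monotone c := fun x y h => max_le_max le_rfl (min_le_min le_rfl h)
  have hceq : fourierHat ψ = fourierHat ψ ∘ c := by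
    ext v
    simp only [Function.comp, c]
    rcases le_total v (-A) with h | h
    · rw [hψ.fourierHat_eq_zero (by rw [abs_of_nonpos (by linarith)]; linarith),
        min_eq_right (by linarith), max_eq_left h,
        hψ.fourierHat_eq_zero (by rw [abs_neg, abs_of_pos hA])]
    · rcases le_total v A with h' | h'
      · rw [min_eq_right h', max_eq_right h]
      · rw [hψ.fourierHat_eq_zero (by rw [abs_of_nonneg (by linarith)]; linarith),
          min_eq_left h', max_eq_right (by linarith),
          hψ.fourierHat_eq_zero (by rw [abs_of_pos hA])]
  have := eVariationOn.comp_le_of_monotoneOn (fourierHat ψ) (s := Icc (-A) A) (t := univ) c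
    (hcm.monotoneOn _) fun v _ => ⟨le_max_left _ _, max_le (by linarith) (min_le_left _ _)⟩
  rw [← hceq] at this
  exact ne_top_of_le_ne_top hψ.boundedVariation this

/-- Injectivity of the Fourier transform on `L¹`, through the uniqueness of characteristic functions
of the finite measures with densities the positive and negative parts. -/
lemma ae_eq_zero_of_fourierHat_eq_zero {χ : ℝ → ℝ} (hχ : Integrable χ)
    (h : ∀ u, fourierHat χ u = 0) : χ =ᵐ[volume] fun _ => 0 := by
  set μ : Measure ℝ := volume.withDensity fun t => ENNReal.ofReal (χ t) with hμ
  set ν : Measure ℝ := volume.withDensity fun t => ENNReal.ofReal (-χ t) with hν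
  have : IsFiniteMeasure μ := isFiniteMeasure_withDensity_ofReal hχ.2
  have : IsFiniteMeasure ν := isFiniteMeasure_withDensity_ofReal hχ.neg.2
  have hm := hχ.aemeasurable
  have hosc : ∀ (u : ℝ) {g : ℝ → ℝ}, Integrable g →
      Integrable (fun t => (g t : ℂ) * Complex.exp (u * t * Complex.I)) := by
    intro u g hg
    refine hg.ofReal.mul_bdd (c := 1) (Continuous.aestronglyMeasurable (by fun_prop)) ?_
    filter_upwards with t
    rw [← Complex.ofReal_mul, Complex.norm_exp_ofReal_mul_I]
  have hmn : AEMeasurable fun t => -χ t := hm.neg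
  have hcf : ∀ u (g : ℝ → ℝ), AEMeasurable g →
      charFun (volume.withDensity fun t => ENNReal.ofReal (g t)) u
      = ∫ t, ((max (g t) 0 : ℝ) : ℂ) * Complex.exp (u * t * Complex.I) := by
    intro u g hg
    rw [charFun_apply_real, integral_withDensity_eq_integral_toReal_smul₀ hg.ennreal_ofReal
      (Eventually.of_forall fun _ => ENNReal.ofReal_lt_top)]
    congr 1 with t
  have hEq : μ = ν := by
    refine Measure.ext_of_charFun ?_
    ext u
    rw [hμ, hν, hcf u _ hm, hcf u _ hmn, ← sub_eq_zero,
      ← integral_sub (hosc u hχ.pos_part) (hosc u hχ.neg_part), ← h (-u), fourierHat]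
    congr 1 with t
    have : ((max (χ t) 0 : ℝ) : ℂ) - ((max (-χ t) 0 : ℝ) : ℂ) = (χ t : ℂ) := by
      rw [← Complex.ofReal_sub]
      congr 1
      rcases le_total (χ t) 0 with h | h
      · rw [max_eq_right h, max_eq_left (by linarith)]
        ring
      · rw [max_eq_left h, max_eq_right (by linarith)]
        ring
    rw [← sub_mul, this, mul_comm]
    congr 2
    push_cast
    ring
  have hae := (withDensity_eq_iff hm.ennreal_ofReal hmn.ennreal_ofReal
    (by
      have := measure_ne_top μ univ
      rwa [hμ, withDensity_apply _ MeasurableSet.univ, Measure.restrict_univ] at this)).1 hEq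
  filter_upwards [hae] with t ht
  rcases le_total (χ t) 0 with h | h
  · rw [ENNReal.ofReal_of_nonpos h, eq_comm, ENNReal.ofReal_eq_zero] at ht
    linarith
  · rw [ENNReal.ofReal_of_nonpos (p := -χ t) (by linarith), ENNReal.ofReal_eq_zero] at ht
    linarith

lemma IsFilter.integrable_sq (hψ : IsFilter A ψ) : Integrable fun v => ‖fourierHat ψ v‖ ^ 2 := by
  simp_rw [sq]
  refine hψ.integrable_fourierHat.norm.bdd_mul (c := ∫ t, |ψ t|)
    hψ.integrable_fourierHat.norm.aestronglyMeasurable (Eventually.of_forall fun v => ?_)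
  rw [norm_norm]
  exact norm_fourierHat_le hψ.integrable v

lemma IsFilter.integral_sq_pos (hψ : IsFilter A ψ) : 0 < ∫ v, ‖fourierHat ψ v‖ ^ 2 := by
  have hc := continuous_fourierHat hψ.integrable
  obtain ⟨u, hu⟩ : ∃ u, fourierHat ψ u ≠ 0 := by
    by_contra! h
    exact hψ.nonzero (ae_eq_zero_of_fourierHat_eq_zero hψ.integrable h)
  have hcs : HasCompactSupport (fourierHat ψ) :=
    HasCompactSupport.of_support_subset_isCompact isCompact_Icc
      ((subset_tsupport _).trans hψ.support_subset)
  refine Continuous.integral_pos_of_hasCompactSupport_nonneg_nonzero (x := u) (by fun_prop)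
    (hcs.comp_left (g := fun z : ℂ => ‖z‖ ^ 2) (by simp)) (fun v => by positivity) ?_
  simpa using hu

variable {s₀ α : ℝ} {h : ℝ → ℝ}

/-- Near the origin the spectral density coincides with a bounded Lipschitz function; it is bounded
below by half of its value at `0`. -/
lemma IsCyclicModel.exists_lipschitz (hm : IsCyclicModel s₀ α h) :
    ∃ (r K B c : ℝ) (w : ℝ → ℝ), 0 < r ∧ 0 < c ∧ (∀ u, |u| ≤ r → w u = cyclicDensity s₀ α h u) ∧
      (∀ x y, |w x - w y| ≤ K * |x - y|) ∧ (∀ u, |w u| ≤ B) ∧ ∀ u, c ≤ w u := by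
  have hs := hm.one_lt_s₀
  have hbase : (fun u : ℝ => |u ^ 2 - s₀ ^ 2| ^ (2 * α)) =ᶠ[𝓝 0]
      fun u => (s₀ ^ 2 - u ^ 2) ^ (2 * α) := by
    have : ∀ᶠ u : ℝ in 𝓝 0, u ^ 2 < s₀ ^ 2 :=
      (by fun_prop : Continuous fun u : ℝ => u ^ 2).continuousAt.eventually_lt
        continuousAt_const (by simpa using (by positivity : 0 < s₀ ^ 2))
    filter_upwards [this] with u hu
    rw [abs_of_neg (by linarith), neg_sub]
  have hcd : ContDiffAt ℝ 1 (cyclicDensity s₀ α h) 0 := by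
    have h1 : ContDiffAt ℝ 1 (fun u => h u / (s₀ ^ 2 - u ^ 2) ^ (2 * α)) 0 := by
      refine ContDiffAt.div ((hm.contDiff.of_le (by norm_num)).contDiffAt) ?_ ?_
      · refine ContDiffAt.rpow_const_of_ne (by fun_prop) ?_
        have : 0 < s₀ ^ 2 := by positivity
        simpa using this.ne'
      · have : 0 < (s₀ ^ 2 - (0 : ℝ) ^ 2) ^ (2 * α) := by
          apply Real.rpow_pos_of_pos
          have : 0 < s₀ ^ 2 := by positivity
          linarith
        exact this.ne'
    refine h1.congr_of_eventuallyEq ?_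
    filter_upwards [hbase] with u hu
    rw [cyclicDensity, hu]
  have hpos : 0 < cyclicDensity s₀ α h 0 := by
    rw [cyclicDensity, hm.h_zero]
    refine div_pos one_pos (Real.rpow_pos_of_pos (abs_pos.2 ?_) _)
    have : 0 < s₀ ^ 2 := by positivity
    linarith
  obtain ⟨K, t, ht, hLip⟩ := hcd.exists_lipschitzOnWith
  have hlow : ∀ᶠ u in 𝓝 (0 : ℝ), cyclicDensity s₀ α h 0 / 2 < cyclicDensity s₀ α h u :=
    hcd.continuousAt.eventually (lt_mem_nhds (by linarith))
  have hup : ∀ᶠ u in 𝓝 (0 : ℝ), cyclicDensity s₀ α h u < 2 * cyclicDensity s₀ α h 0 :=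
    hcd.continuousAt.eventually (gt_mem_nhds (by linarith))
  obtain ⟨r, hr, hball⟩ := Metric.nhds_basis_closedBall.mem_iff.1
    (inter_mem ht (inter_mem hlow hup))
  -- precompose with the projection onto `[-r, r]`, which is a contraction
  set p : ℝ → ℝ := fun u => max (-r) (min r u) with hp
  have hpmem : ∀ u, p u ∈ Metric.closedBall (0 : ℝ) r := by
    intro u
    rw [mem_closedBall_zero_iff, Real.norm_eq_abs, abs_le]
    exact ⟨le_max_left _ _, max_le (by linarith) (min_le_left _ _)⟩
  have hpLip : ∀ x y, |p x - p y| ≤ |x - y| := by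
    intro x y
    have h1 := abs_max_sub_max_le_abs (min r x) (min r y) (-r)
    have h2 := abs_min_sub_min_le_max r x r y
    simp only [sub_self, abs_zero] at h2
    rw [max_eq_right (abs_nonneg _)] at h2
    rw [max_comm _ (-r), max_comm _ (-r)] at h1
    exact h1.trans h2
  refine ⟨r, K, 2 * cyclicDensity s₀ α h 0, cyclicDensity s₀ α h 0 / 2,
    fun u => cyclicDensity s₀ α h (p u), hr, by positivity, ?_, ?_, ?_, ?_⟩
  · intro u hu
    obtain ⟨h1, h2⟩ := abs_le.1 hu
    simp only [hp]
    rw [min_eq_right h2, max_eq_right h1]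
  · intro x y
    have := hLip.dist_le_mul _ (hball (hpmem x)).1 _ (hball (hpmem y)).1
    rw [Real.dist_eq, Real.dist_eq] at this
    exact this.trans (mul_le_mul_of_nonneg_left (hpLip x y) K.2)
  · intro u
    have h1 := (hball (hpmem u)).2.1
    have h2 := (hball (hpmem u)).2.2
    simp only [mem_ofPred_eq] at h1 h2
    rw [abs_of_nonneg (by linarith)]
    exact h2.le
  · intro u
    exact (hball (hpmem u)).2.1.le


/-! ### Covariances of the filter coefficients -/

/-- The kernel `t ↦ a^{-1/2} ψ((t - b) / a)` of the filter transform. -/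
def filterKernel (ψ : ℝ → ℝ) (a b t : ℝ) : ℝ := 1 / √a * ψ ((t - b) / a)

lemma integrable_comp_filter (hψ : Integrable ψ) {a : ℝ} (ha : 0 < a) (b : ℝ) :
    Integrable fun t => ψ ((t - b) / a) :=
  (hψ.comp_div ha.ne').comp_sub_right b

lemma integrable_filterKernel (hψ : Integrable ψ) {a : ℝ} (ha : 0 < a) (b : ℝ) :
    Integrable (filterKernel ψ a b) := (integrable_comp_filter hψ ha b).const_mul _

lemma fourierHat_filterKernel {a : ℝ} (ha : 0 < a) (b u : ℝ) :
    fourierHat (filterKernel ψ a b) u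
      = √a * Complex.exp (-(Complex.I * ((u * b : ℝ) : ℂ))) * fourierHat ψ (a * u) := by
  set g : ℝ → ℂ := fun s =>
    Complex.exp (-(Complex.I * ((u * (a * s + b) : ℝ) : ℂ))) * (ψ s : ℂ) with hg
  have h1 : fourierHat (filterKernel ψ a b) u = ((1 / √a : ℝ) : ℂ) * ∫ t, g ((t - b) / a) := by
    rw [← integral_const_mul, fourierHat]
    congr 1 with t
    rw [hg, filterKernel]
    have : a * ((t - b) / a) + b = t := by
      field_simp
      ring
    simp only [this, Complex.ofReal_mul]
    ring
  have h2 : ∫ t, g ((t - b) / a) = (a : ℂ) * ∫ s, g s := by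
    rw [integral_sub_right_eq_self (fun t => g (t / a)) b, Measure.integral_comp_div,
      abs_of_pos ha, Complex.real_smul]
  have h3 : ∫ s, g s = Complex.exp (-(Complex.I * ((u * b : ℝ) : ℂ))) * fourierHat ψ (a * u) := by
    rw [fourierHat, ← integral_const_mul]
    congr 1 with s
    rw [hg, ← mul_assoc, ← Complex.exp_add]
    dsimp only
    congr 2
    push_cast
    ring
  have h4 : ((1 / √a : ℝ) : ℂ) * (a : ℂ) = (√a : ℝ) := by
    rw [← Complex.ofReal_mul]
    congr 1
    rw [one_div, inv_mul_eq_div, Real.div_sqrt]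
  rw [h1, h2, h3, ← mul_assoc, h4, mul_assoc]

section Covariance

variable {Ω : Type*} [MeasurableSpace Ω] {P : Measure Ω} [IsProbabilityMeasure P]
  {X : ℝ → Ω → ℝ}

/-- After the substitution `v = a u`, the covariance of two filter coefficients at the scale `a` is
a Fourier integral of `|ψ̂(v)|² f(v / a)`. -/
lemma inner_integralL2_filterKernel (hX : IsStationaryGaussian X P) {f : ℝ → ℝ}
    (hf : IsSpectralDensity X P f) (hψ : Integrable ψ) {a : ℝ} (ha : 0 < a) (b b' : ℝ) :
    ((inner ℝ (hX.integralL2 (filterKernel ψ a b)) (hX.integralL2 (filterKernel ψ a b')) : ℝ) : ℂ)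
      = ∫ v, Complex.exp (Complex.I * ((v * ((b - b') / a) : ℝ) : ℂ)) *
          ((‖fourierHat ψ v‖ ^ 2 * f (v / a) : ℝ) : ℂ) := by
  rw [hX.inner_integralL2 hf.isSpectralMeasure (integrable_filterKernel hψ ha b)
    (integrable_filterKernel hψ ha b'), integral_withDensity_eq_integral_toReal_smul₀
      hf.integrable.aemeasurable.ennreal_ofReal
      (Eventually.of_forall fun _ => ENNReal.ofReal_lt_top)]
  set g : ℝ → ℂ := fun v => Complex.exp (Complex.I * ((v * ((b - b') / a) : ℝ) : ℂ)) *
          ((‖fourierHat ψ v‖ ^ 2 * f (v / a) : ℝ) : ℂ) with hg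
  have h1 : ∫ v, g v = (a : ℂ) * ∫ u, g (a * u) := by
    rw [Measure.integral_comp_mul_left, abs_of_pos (inv_pos.2 ha), Complex.real_smul, ← mul_assoc,
      ← Complex.ofReal_mul, mul_inv_cancel₀ ha.ne', Complex.ofReal_one, one_mul]
  rw [h1, ← integral_const_mul]
  congr 1 with u
  rw [ENNReal.toReal_ofReal (hf.nonneg u), Complex.real_smul, fourierHat_filterKernel ha,
    fourierHat_filterKernel ha, map_mul, map_mul, ← Complex.exp_conj, hg]
  have e1 : a * u / a = u := by field_simp
  have e2 : Complex.exp (Complex.I * ((a * u * ((b - b') / a) : ℝ) : ℂ))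
      = Complex.exp (Complex.I * ((u * b : ℝ) : ℂ)) *
        Complex.exp (-(Complex.I * ((u * b' : ℝ) : ℂ))) := by
    rw [← Complex.exp_add]
    congr 1
    have : a * u * ((b - b') / a) = u * b - u * b' := by field_simp
    rw [this]
    push_cast
    ring
  have e3 : (((‖fourierHat ψ (a * u)‖ ^ 2 : ℝ)) : ℂ)
      = (starRingEnd ℂ) (fourierHat ψ (a * u)) * fourierHat ψ (a * u) := by
    rw [Complex.conj_mul']
    push_cast
    ring
  have e4 : (a : ℂ) = (√a : ℝ) * (√a : ℝ) := by
    rw [← Complex.ofReal_mul, Real.mul_self_sqrt ha.le]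
  simp only [e1, e2]
  rw [Complex.ofReal_mul (‖fourierHat ψ (a * u)‖ ^ 2), e3]
  simp only [map_neg, map_mul, Complex.conj_I, Complex.conj_ofReal, neg_mul, neg_neg]
  linear_combination (-((starRingEnd ℂ) (fourierHat ψ (a * u)) * fourierHat ψ (a * u) * (f u : ℂ) *
    Complex.exp (Complex.I * ((u * b : ℝ) : ℂ)) *
    Complex.exp (-(Complex.I * ((u * b' : ℝ) : ℂ))))) * e4

/-- At large scales the coefficients have variances bounded from above and below, and
covariances of the order of the inverse of the rescaled distance of the shifts. -/
lemma exists_covariance_bounds (hX : IsStationaryGaussian X P) (hm : IsCyclicModel s₀ α h)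
    (hf : IsSpectralDensity X P (cyclicDensity s₀ α h)) (hψ : IsFilter A ψ) :
    ∃ (a₀ c C : ℝ), 0 < c ∧ 0 < C ∧ ∀ a, 0 < a → a₀ ≤ a → ∀ b b' : ℝ,
      |(inner ℝ (hX.integralL2 (filterKernel ψ a b)) (hX.integralL2 (filterKernel ψ a b')) : ℝ)|
        ≤ C ∧
      (b ≠ b' → |(inner ℝ (hX.integralL2 (filterKernel ψ a b))
        (hX.integralL2 (filterKernel ψ a b')) : ℝ)| ≤ C * (a / |b - b'|)) ∧
      c ≤ (inner ℝ (hX.integralL2 (filterKernel ψ a b)) (hX.integralL2 (filterKernel ψ a b)) : ℝ)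
      := by
  obtain ⟨r, K, B, c, w, hr, hc, hwf, hwK, hwB, hwc⟩ := hm.exists_lipschitz
  set G := fourierHat ψ with hGdef
  have hGi : Integrable G := hψ.integrable_fourierHat
  have hGc : Continuous G := continuous_fourierHat hψ.integrable
  have hG2 : Integrable fun v => ‖G v‖ ^ 2 := hψ.integrable_sq
  set I := ∫ v, ‖G v‖ ^ 2 with hI
  have hIpos : 0 < I := hψ.integral_sq_pos
  have hGM : ∀ v, ‖G v‖ ≤ ∫ t, |ψ t| := norm_fourierHat_le hψ.integrable
  set M := ∫ t, |ψ t|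
  obtain ⟨V, hV⟩ := exists_integral_norm_translate_sub_le hGi hψ.boundedVariationOn_univ
  have hB0 : 0 ≤ B := (abs_nonneg _).trans (hwB 0)
  have hK0 : 0 ≤ K := by simpa using (abs_nonneg _).trans (hwK 1 0)
  have hwcont : Continuous w := by
    refine LipschitzWith.continuous (K := ⟨K, hK0⟩) (LipschitzWith.of_dist_le_mul fun x y => ?_)
    rw [Real.dist_eq, Real.dist_eq]
    exact hwK x y
  set D := 2 * M * B * V + M * K * ∫ v, ‖G v‖ with hD
  refine ⟨max 1 (A / r), c * I, max (B * I) (Real.pi * D / 2) , by positivity,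
    lt_max_of_lt_left ?_, ?_⟩
  · exact mul_pos (hc.trans_le ((hwc 0).trans ((le_abs_self _).trans (hwB 0)))) hIpos
  intro a ha haa b b'
  have ha1 : 1 ≤ a := (le_max_left _ _).trans haa
  have har : A ≤ a * r := (div_le_iff₀ hr).1 ((le_max_right _ _).trans haa)
  set g : ℝ → ℂ := fun v => ((‖G v‖ ^ 2 * w (v / a) : ℝ) : ℂ) with hg
  -- for `a ≥ A / r` the density at `v / a` is replaced by `w` on the support of `ψ̂`
  have hgf : ∀ v, ((‖G v‖ ^ 2 * cyclicDensity s₀ α h (v / a) : ℝ) : ℂ) = g v := by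
    intro v
    rcases le_total A |v| with hv | hv
    · have : G v = 0 := hψ.fourierHat_eq_zero hv
      simp [hg, this]
    · simp only [hg]
      rw [hwf (v / a)]
      rw [abs_div, abs_of_pos ha, div_le_iff₀ ha]
      linarith
  have hgr : Integrable fun v => ‖G v‖ ^ 2 * w (v / a) := by
    refine hG2.mul_bdd (c := B) (Continuous.aestronglyMeasurable (by fun_prop))
      (Eventually.of_forall fun v => hwB _)
  have hgi : Integrable g := hgr.ofReal
  have hrep : ∀ b b' : ℝ, ((inner ℝ (hX.integralL2 (filterKernel ψ a b))
      (hX.integralL2 (filterKernel ψ a b')) : ℝ) : ℂ)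
      = ∫ v, Complex.exp (Complex.I * ((v * ((b - b') / a) : ℝ) : ℂ)) * g v := by
    intro b b'
    rw [inner_integralL2_filterKernel hX hf hψ.integrable ha]
    simp_rw [← hGdef, hgf]
  refine ⟨?_, fun hb => ?_, ?_⟩
  · refine le_trans ?_ (le_max_left _ _)
    rw [← Real.norm_eq_abs, ← Complex.norm_real, hrep, mul_comm B, ← integral_mul_const]
    refine norm_integral_le_of_norm_le (hG2.mul_const B) (Eventually.of_forall fun v => ?_)
    rw [norm_mul, Complex.norm_exp_I_mul_ofReal, one_mul, Complex.norm_real, norm_mul, norm_pow,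
      norm_norm]
    gcongr
    exact hwB _
  · have hbb : 0 < |b - b'| := abs_pos.2 (sub_ne_zero.2 hb)
    have hshift : ∀ d : ℝ, 0 ≤ d → ∫ v, ‖g (v + d) - g v‖ ≤ d * D :=
      integral_norm_translate_sub_sq_mul_le hGi hGM hV (w := fun v => w (v / a))
        (fun v => hwB _) fun x y => (hwK _ _).trans (by
          rw [← sub_div, abs_div, abs_of_pos ha]
          exact mul_le_mul_of_nonneg_left (div_le_self (abs_nonneg _) ha1) hK0)
    have := norm_integral_exp_mul_le hgi hshift
      (div_ne_zero (sub_ne_zero.2 hb) ha.ne')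
    rw [← hrep, Complex.norm_real, Real.norm_eq_abs] at this
    refine this.trans ?_
    rw [abs_div, abs_of_pos ha]
    have e : Real.pi * D / (2 * (|b - b'| / a)) = Real.pi * D / 2 * (a / |b - b'|) := by
      field_simp
    rw [e]
    gcongr
    exact le_max_right _ _
  · have h1 : (inner ℝ (hX.integralL2 (filterKernel ψ a b))
        (hX.integralL2 (filterKernel ψ a b)) : ℝ) = ∫ v, ‖G v‖ ^ 2 * w (v / a) := by
      have := hrep b b
      simp only [sub_self, zero_div, mul_zero, Complex.ofReal_zero, Complex.exp_zero, one_mul,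
        hg, integral_complex_ofReal] at this
      exact_mod_cast this
    rw [h1, mul_comm, ← integral_mul_const]
    refine integral_mono (hG2.mul_const _) hgr fun v => ?_
    dsimp only
    gcongr
    exact hwc _

end Covariance

/-! ### Quadratic forms in Gaussian vectors -/

section Matrix

open Matrix

variable {ι : Type*} [Fintype ι] [DecidableEq ι]

lemma exists_orthogonal_diagonalization {R : Matrix ι ι ℝ} (hR : R.IsHermitian) :
    ∃ (U : Matrix ι ι ℝ) (d : ι → ℝ), Uᵀ * U = 1 ∧ U * Uᵀ = 1 ∧ Uᵀ * R * U = diagonal d := by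
  have hU1 : (hR.eigenvectorUnitary : Matrix ι ι ℝ)ᵀ * (hR.eigenvectorUnitary : Matrix ι ι ℝ) = 1 :=
    Unitary.coe_star_mul_self hR.eigenvectorUnitary
  have hU2 : (hR.eigenvectorUnitary : Matrix ι ι ℝ) * (hR.eigenvectorUnitary : Matrix ι ι ℝ)ᵀ = 1 :=
    Unitary.coe_mul_star_self hR.eigenvectorUnitary
  have hsp : R = (hR.eigenvectorUnitary : Matrix ι ι ℝ) * diagonal (fun i => hR.eigenvalues i) *
      (hR.eigenvectorUnitary : Matrix ι ι ℝ)ᵀ := by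
    have := hR.spectral_theorem
    rwa [Unitary.conjStarAlgAut_apply] at this
  refine ⟨(hR.eigenvectorUnitary : Matrix ι ι ℝ), fun i => hR.eigenvalues i, hU1, hU2, ?_⟩
  set U : Matrix ι ι ℝ := (hR.eigenvectorUnitary : Matrix ι ι ℝ)
  set D : Matrix ι ι ℝ := diagonal fun i => hR.eigenvalues i
  calc Uᵀ * R * U = Uᵀ * (U * D * Uᵀ) * U := by rw [← hsp]
    _ = (Uᵀ * U) * D * (Uᵀ * U) := by simp only [Matrix.mul_assoc]
    _ = D := by rw [hU1, Matrix.one_mul, Matrix.mul_one]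

variable {R U : Matrix ι ι ℝ} {d : ι → ℝ}

lemma sum_sq_diagonal_eq (hR : Rᵀ = R) (h2 : U * Uᵀ = 1) (hd : Uᵀ * R * U = diagonal d) :
    ∑ i, d i ^ 2 = ∑ k, ∑ l, R k l ^ 2 := by
  have e1 : ∑ i, d i ^ 2 = trace (diagonal d * diagonal d) := by
    simp [diagonal_mul_diagonal, trace_diagonal, sq]
  have e2 : trace (R * R) = ∑ k, ∑ l, R k l ^ 2 := by
    simp only [trace, diag_apply, mul_apply, sq]
    refine Finset.sum_congr rfl fun k _ => Finset.sum_congr rfl fun l _ => ?_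
    congr 1
    exact congrFun (congrFun hR k) l
  rw [e1, ← hd, ← e2]
  have : Uᵀ * R * U * (Uᵀ * R * U) = Uᵀ * (R * R) * U := by
    calc _ = Uᵀ * R * (U * Uᵀ) * R * U := by simp only [Matrix.mul_assoc]
      _ = _ := by
        rw [h2, Matrix.mul_one]
        simp only [Matrix.mul_assoc]
  rw [this, Matrix.mul_assoc, trace_mul_comm, Matrix.mul_assoc, h2, Matrix.mul_one]

/-- The spectral radius is at most the maximal absolute row sum. -/
lemma diagonal_le_of_row_sum_le (h1 : Uᵀ * U = 1) (h2 : U * Uᵀ = 1) (hd : Uᵀ * R * U = diagonal d)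
    {B : ℝ} (hB : ∀ k, ∑ l, |R k l| ≤ B) (i : ι) : d i ≤ B := by
  have heig : R * U = U * diagonal d := by
    rw [← hd, ← Matrix.mul_assoc, ← Matrix.mul_assoc, h2, Matrix.one_mul]
  have hcol : ∀ k, ∑ l, R k l * U l i = U k i * d i := by
    intro k
    have := congrFun (congrFun heig k) i
    rwa [mul_apply, mul_diagonal] at this
  have : Nonempty ι := ⟨i⟩
  obtain ⟨k, hk⟩ := Finite.exists_max fun k => |U k i|
  have hpos : 0 < |U k i| := by
    by_contra hneg
    have hz : ∀ l, U l i = 0 := fun l => abs_nonpos_iff.1 ((hk l).trans (not_lt.1 hneg))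
    have := congrFun (congrFun h1 i) i
    rw [mul_apply] at this
    simp [hz] at this
  have : d i * |U k i| ≤ B * |U k i| := by
    calc d i * |U k i| ≤ |U k i * d i| := by
          rw [abs_mul, mul_comm]
          exact mul_le_mul_of_nonneg_left (le_abs_self _) (abs_nonneg _)
      _ ≤ ∑ l, |R k l| * |U l i| := by
          rw [← hcol]
          refine (Finset.abs_sum_le_sum_abs _ _).trans (le_of_eq ?_)
          simp_rw [abs_mul]
      _ ≤ ∑ l, |R k l| * |U k i| := by
          exact Finset.sum_le_sum fun l _ => mul_le_mul_of_nonneg_left (hk l) (abs_nonneg _)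
      _ ≤ B * |U k i| := by
          rw [← Finset.sum_mul]
          gcongr
          exact hB k
  exact le_of_mul_le_mul_right this hpos

end Matrix

section Diagonalization

variable {Ω : Type*} [MeasurableSpace Ω] {P : Measure Ω} [IsProbabilityMeasure P]
  {ι : Type*} [Fintype ι]

/-- Rotation of a centered Gaussian vector to independent coordinates, the variances `d i` of which
are the eigenvalues of its covariance matrix. -/
lemma exists_independent_coordinates {δ : ι → Ω → ℝ} (hδ : HasGaussianLaw (fun ω i => δ i ω) P)
    (h0 : ∀ i, ∫ ω, δ i ω ∂P = 0) :
    ∃ (η : ι → Ω → ℝ) (d : ι → ℝ), iIndepFun η P ∧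
      (∀ i, HasLaw (η i) (gaussianReal 0 (d i).toNNReal) P) ∧ (∀ i, 0 ≤ d i) ∧
      (∀ ω, ∑ i, δ i ω ^ 2 = ∑ i, η i ω ^ 2) ∧
      ∑ i, d i ^ 2 = ∑ k, ∑ l, cov[δ k, δ l; P] ^ 2 ∧
      ∀ B : ℝ, (∀ k, ∑ l, |cov[δ k, δ l; P]| ≤ B) → ∀ i, d i ≤ B := by
  classical
  set R : Matrix ι ι ℝ := Matrix.of fun k l => cov[δ k, δ l; P] with hRdef
  have hRs : R.transpose = R := by
    ext k l
    exact covariance_comm _ _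
  obtain ⟨U, d, h1, h2, hd⟩ := exists_orthogonal_diagonalization (R := R) hRs
  have hL2 : ∀ i, MemLp (δ i) 2 P := fun i => (hδ.eval i).memLp_two
  set η : ι → Ω → ℝ := fun i ω => ∑ k, U k i * δ k ω with hη
  have hcov : ∀ i j, cov[η i, η j; P] = Matrix.diagonal d i j := by
    intro i j
    have hs : ∀ i k, MemLp (fun ω => U k i * δ k ω) 2 P := fun i k => (hL2 k).const_mul _
    rw [hη, covariance_fun_sum_fun_sum (hs i) (hs j), ← hd, Matrix.mul_assoc, Matrix.mul_apply]
    refine Finset.sum_congr rfl fun k _ => ?_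
    rw [Matrix.mul_apply, Finset.mul_sum]
    refine Finset.sum_congr rfl fun l _ => ?_
    rw [covariance_const_mul_left, covariance_const_mul_right, Matrix.transpose_apply, hRdef,
      Matrix.of_apply]
    ring
  have hηG : HasGaussianLaw (fun ω i => η i ω) P := by
    let L : (ι → ℝ) →L[ℝ] (ι → ℝ) := LinearMap.toContinuousLinearMap (Matrix.toLin' U.transpose)
    have := hδ.map_fun L
    convert! this using 2 with ω
  have hmean : ∀ i, ∫ ω, η i ω ∂P = 0 := by
    intro i
    rw [hη, integral_finsetSum _ fun k _ => ((hL2 k).integrable (by norm_num)).const_mul _]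
    simp [integral_const_mul, h0]
  have hvar : ∀ i, Var[η i; P] = d i := by
    intro i
    rw [← covariance_self (hηG.eval i).aemeasurable, hcov, Matrix.diagonal_apply_eq]
  refine ⟨η, d, hηG.iIndepFun_of_covariance_eq_zero fun i j hij => ?_, fun i => ⟨?_, ?_⟩,
    fun i => ?_, fun ω => ?_, sum_sq_diagonal_eq hRs h2 hd,
    fun B hB => diagonal_le_of_row_sum_le h1 h2 hd hB⟩
  · rw [hcov, Matrix.diagonal_apply_ne _ hij]
  · exact (hηG.eval i).aemeasurable
  · rw [(hηG.eval i).map_eq_gaussianReal, hmean, hvar]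
  · rw [← hvar]
    exact variance_nonneg _ _
  · have key : ∀ k l, ∑ i, U k i * U l i = if k = l then 1 else 0 := by
      intro k l
      have := congrFun (congrFun h2 k) l
      rwa [Matrix.mul_apply, Matrix.one_apply] at this
    calc ∑ k, δ k ω ^ 2 = ∑ k, ∑ l, (if k = l then 1 else 0) * (δ k ω * δ l ω) := by
          simp [sq]
      _ = ∑ k, ∑ l, ∑ i, U k i * U l i * (δ k ω * δ l ω) := by
          simp_rw [← key, Finset.sum_mul]
      _ = ∑ i, ∑ k, ∑ l, U k i * U l i * (δ k ω * δ l ω) := by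
          rw [Finset.sum_congr rfl fun _ _ => Finset.sum_comm, Finset.sum_comm]
      _ = ∑ i, η i ω ^ 2 := by
          refine Finset.sum_congr rfl fun i _ => ?_
          rw [hη, sq, Finset.sum_mul_sum]
          refine Finset.sum_congr rfl fun k _ => Finset.sum_congr rfl fun l _ => ?_
          ring

end Diagonalization

/-! ### Sums of squares of independent centered Gaussian variables -/

/-- The variance of the square of a standard Gaussian variable. -/
def chiSqVariance : ℝ := Var[fun z : ℝ => z ^ 2; gaussianReal 0 1]

/-- The law of a centered and normalized chi-squared variable with one degree of freedom. -/
def chiSqLaw : Measure ℝ := (gaussianReal 0 1).map fun z => (z ^ 2 - 1) / √chiSqVariance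

lemma memLp_sq_gaussianReal : MemLp (fun z : ℝ => z ^ 2) 2 (gaussianReal 0 1) := by
  have h : MemLp (fun z : ℝ => z) 4 (gaussianReal 0 1) := memLp_id_gaussianReal 4
  refine (memLp_two_iff_integrable_sq (by fun_prop)).2 ?_
  refine (h.integrable_norm_pow (by norm_num)).congr (Eventually.of_forall fun z => ?_)
  simp only [Real.norm_eq_abs]
  rw [← pow_mul, Even.pow_abs (by decide)]

lemma integral_sq_gaussianReal : ∫ z, z ^ 2 ∂(gaussianReal 0 1) = 1 := by
  have h := variance_id_gaussianReal (μ := 0) (v := 1)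
  rw [variance_of_integral_eq_zero aemeasurable_id integral_id_gaussianReal] at h
  simpa using h

lemma chiSqVariance_pos : 0 < chiSqVariance := by
  refine lt_of_le_of_ne (variance_nonneg _ _) fun h => ?_
  -- otherwise a Gaussian variable would be concentrated on two points
  have hae := ae_eq_integral_of_variance_eq_zero memLp_sq_gaussianReal h.symm
  have hnull : gaussianReal 0 1 ({1, -1} : Set ℝ) = 0 := by
    have := nullSingletonClass_gaussianReal (μ := 0) (v := 1) one_ne_zero
    exact (Set.toFinite _).measure_zero _
  have : ∀ᵐ z ∂(gaussianReal 0 1), False := by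
    filter_upwards [hae, measure_eq_zero_iff_ae_notMem.1 hnull] with z h1 h2
    rw [integral_sq_gaussianReal] at h1
    exact h2 (by simpa using h1)
  exact this.exists.choose_spec

instance : IsProbabilityMeasure chiSqLaw := Measure.isProbabilityMeasure_map (by fun_prop)

/-- To second order at the origin, the characteristic function of the normalized chi-squared law
agrees with that of the standard Gaussian law. -/
lemma charFun_chiSqLaw_sub_isLittleO :
    (fun x : ℝ => charFun chiSqLaw x - charFun (gaussianReal 0 1) x) =o[𝓝 0] fun x => x ^ 2 := by
  have hint : Integrable (fun z : ℝ => z ^ 2) (gaussianReal 0 1) :=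
    memLp_sq_gaussianReal.integrable (by norm_num)
  have h1 := taylor_charFun_two (P := gaussianReal 0 1)
    (X := fun z : ℝ => (z ^ 2 - 1) / √chiSqVariance) (by fun_prop)
    (by
      rw [integral_div, integral_sub hint (integrable_const _), integral_sq_gaussianReal]
      simp)
    (by
      have hv : chiSqVariance = ∫ z, (z ^ 2 - 1) ^ 2 ∂(gaussianReal 0 1) := by
        rw [chiSqVariance, variance_eq_integral (by fun_prop), integral_sq_gaussianReal]
      simp only [Pi.pow_apply, div_pow]
      rw [integral_div, ← hv, Real.sq_sqrt chiSqVariance_pos.le, div_self chiSqVariance_pos.ne'])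
  have h2 := taylor_charFun_two (P := gaussianReal 0 1) (X := fun z : ℝ => z) (by fun_prop)
    integral_id_gaussianReal integral_sq_gaussianReal
  rw [Measure.map_id'] at h2
  refine (h1.sub h2).congr_left fun x => ?_
  rw [chiSqLaw]
  ring

lemma norm_prod_sub_prod_le {ι : Type*} (s : Finset ι) (f g : ι → ℂ) (hf : ∀ i, ‖f i‖ ≤ 1)
    (hg : ∀ i, ‖g i‖ ≤ 1) : ‖∏ i ∈ s, f i - ∏ i ∈ s, g i‖ ≤ ∑ i ∈ s, ‖f i - g i‖ := by
  classical
  induction s using Finset.induction_on with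
  | empty => simp
  | insert i s hi ih =>
    rw [Finset.prod_insert hi, Finset.prod_insert hi, Finset.sum_insert hi]
    have e : f i * ∏ j ∈ s, f j - g i * ∏ j ∈ s, g j
        = (f i - g i) * ∏ j ∈ s, f j + g i * (∏ j ∈ s, f j - ∏ j ∈ s, g j) := by ring
    rw [e]
    refine (norm_add_le _ _).trans (add_le_add ?_ ?_)
    · rw [norm_mul]
      refine mul_le_of_le_one_right (norm_nonneg _) ((Finset.norm_prod_le _ _).trans ?_)
      exact Finset.prod_le_one (fun _ _ => norm_nonneg _) fun j _ => hf j
    · rw [norm_mul]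
      exact (mul_le_of_le_one_left (norm_nonneg _) (hg i)).trans ih

/-- The central limit theorem for weighted sums of independent normalized chi-squared variables
with uniformly negligible weights, in terms of characteristic functions. -/
lemma tendsto_prod_charFun_chiSqLaw {ι : ℕ → Type*} [∀ n, Fintype (ι n)] {x : ∀ n, ι n → ℝ}
    {t : ℝ} (hsum : ∀ᶠ n in atTop, ∑ i, x n i ^ 2 = t ^ 2) {e : ℕ → ℝ}
    (he : Tendsto e atTop (𝓝 0)) (hx : ∀ᶠ n in atTop, ∀ i, |x n i| ≤ e n) :
    Tendsto (fun n => ∏ i, charFun chiSqLaw (x n i)) atTop (𝓝 (charFun (gaussianReal 0 1) t)) := by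
  have hprod : ∀ᶠ n in atTop, ∏ i, charFun (gaussianReal 0 1) (x n i)
      = charFun (gaussianReal 0 1) t := by
    filter_upwards [hsum] with n hn
    simp only [charFun_gaussianReal, ← Complex.exp_sum]
    congr 1
    have : (t : ℂ) ^ 2 = ∑ i, (x n i : ℂ) ^ 2 := by exact_mod_cast hn.symm
    simp [this, Finset.sum_div]
  rw [Metric.tendsto_nhds]
  intro ε hε
  have hε' : 0 < ε / (t ^ 2 + 1) := by positivity
  have hlo := charFun_chiSqLaw_sub_isLittleO.bound hε'
  obtain ⟨r, hr, hball⟩ := Metric.eventually_nhds_iff.1 hlo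
  filter_upwards [hprod, hsum, hx, he.eventually (gt_mem_nhds hr)] with n h1 h2 h3 h4
  rw [dist_eq_norm, ← h1]
  calc _ ≤ ∑ i, ‖charFun chiSqLaw (x n i) - charFun (gaussianReal 0 1) (x n i)‖ :=
        norm_prod_sub_prod_le _ _ _ (fun i => norm_charFun_le_one _) fun i => norm_charFun_le_one _
    _ ≤ ∑ i, ε / (t ^ 2 + 1) * x n i ^ 2 := by
        refine Finset.sum_le_sum fun i _ => ?_
        have := hball (y := x n i) (by
          rw [Real.dist_eq, sub_zero]
          exact (h3 i).trans_lt h4)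
        rwa [Real.norm_of_nonneg (sq_nonneg _)] at this
    _ = ε / (t ^ 2 + 1) * t ^ 2 := by rw [← Finset.mul_sum, h2]
    _ < ε := by
        rw [div_mul_eq_mul_div, div_lt_iff₀ (by positivity)]
        nlinarith

section SumSq

variable {Ω : Type*} [MeasurableSpace Ω] {P : Measure Ω} {ι : Type*} [Fintype ι]

lemma hasLaw_sq_of_gaussianReal {η : Ω → ℝ} {d : ℝ} (hd : 0 ≤ d)
    (hη : HasLaw η (gaussianReal 0 d.toNNReal) P) :
    HasLaw (fun ω => η ω ^ 2) ((gaussianReal 0 1).map fun z => d * z ^ 2) P := by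
  refine ⟨by have := hη.aemeasurable; fun_prop, ?_⟩
  have h1 : P.map (fun ω => η ω ^ 2) = (gaussianReal 0 d.toNNReal).map fun z => z ^ 2 := by
    rw [← hη.map_eq, AEMeasurable.map_map_of_aemeasurable (by fun_prop) hη.aemeasurable]
    rfl
  have h2 : gaussianReal 0 d.toNNReal = (gaussianReal 0 1).map (√d * ·) := by
    rw [gaussianReal_map_const_mul]
    congr 1
    · simp
    · ext
      simp [Real.sq_sqrt hd, hd]
  rw [h1, h2, Measure.map_map (by fun_prop) (by fun_prop)]
  congr 1 with z
  simp [mul_pow, Real.sq_sqrt hd]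

variable {η : ι → Ω → ℝ} {d : ι → ℝ}

lemma memLp_sq_of_gaussianReal {η : Ω → ℝ} {d : ℝ} (hd : 0 ≤ d)
    (hη : HasLaw η (gaussianReal 0 d.toNNReal) P) : MemLp (fun ω => η ω ^ 2) 2 P := by
  have hl := hasLaw_sq_of_gaussianReal hd hη
  have h1 : MemLp (fun z : ℝ => z) 2 ((gaussianReal 0 1).map fun z => d * z ^ 2) :=
    (memLp_map_measure_iff (by fun_prop) (by fun_prop)).2 (memLp_sq_gaussianReal.const_mul d)
  rw [← hl.map_eq] at h1
  exact (memLp_map_measure_iff (by fun_prop) hl.aemeasurable).1 h1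

lemma integral_sq_of_gaussianReal {η : Ω → ℝ} {d : ℝ} (hd : 0 ≤ d)
    (hη : HasLaw η (gaussianReal 0 d.toNNReal) P) : ∫ ω, η ω ^ 2 ∂P = d := by
  rw [(hasLaw_sq_of_gaussianReal hd hη).integral_eq, integral_map (by fun_prop) (by fun_prop),
    integral_const_mul, integral_sq_gaussianReal, mul_one]

lemma variance_sq_of_gaussianReal {η : Ω → ℝ} {d : ℝ} (hd : 0 ≤ d)
    (hη : HasLaw η (gaussianReal 0 d.toNNReal) P) :
    Var[fun ω => η ω ^ 2; P] = chiSqVariance * d ^ 2 := by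
  rw [(hasLaw_sq_of_gaussianReal hd hη).variance_eq, variance_map (by fun_prop) (by fun_prop)]
  simp only [Function.comp_def, id_eq]
  rw [variance_const_mul, chiSqVariance, mul_comm]

lemma variance_sum_sq (hind : iIndepFun η P)
    (hη : ∀ i, HasLaw (η i) (gaussianReal 0 (d i).toNNReal) P) (hd : ∀ i, 0 ≤ d i) :
    Var[fun ω => ∑ i, η i ω ^ 2; P] = chiSqVariance * ∑ i, d i ^ 2 := by
  have hsq : iIndepFun (fun i ω => η i ω ^ 2) P := hind.comp (fun _ z => z ^ 2) (by fun_prop)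
  have := IndepFun.variance_sum (s := Finset.univ) (X := fun i ω => η i ω ^ 2)
    (fun i _ => memLp_sq_of_gaussianReal (hd i) (hη i)) fun i _ j _ hij => hsq.indepFun hij
  rw [Finset.mul_sum, ← Finset.sum_congr rfl fun i _ => variance_sq_of_gaussianReal (hd i) (hη i),
    ← this]
  congr 1
  ext ω
  simp

variable [IsProbabilityMeasure P]

/-- The standardized sum of squares is a weighted sum of independent normalized chi-squared
variables. -/
lemma charFun_standardize_sum_sq (hind : iIndepFun η P)
    (hη : ∀ i, HasLaw (η i) (gaussianReal 0 (d i).toNNReal) P) (hd : ∀ i, 0 ≤ d i) (t : ℝ) :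
    charFun (P.map (standardize (fun ω => ∑ i, η i ω ^ 2) P)) t
      = ∏ i, charFun chiSqLaw (d i / √(∑ i, d i ^ 2) * t) := by
  set s := √(∑ i, d i ^ 2) with hs
  set v := √chiSqVariance with hv
  have hv0 : v ≠ 0 := (Real.sqrt_pos.2 chiSqVariance_pos).ne'
  have hmean : ∫ ω, ∑ i, η i ω ^ 2 ∂P = ∑ i, d i := by
    rw [integral_finsetSum _ fun i _ =>
      (memLp_sq_of_gaussianReal (hd i) (hη i)).integrable (by norm_num)]
    exact Finset.sum_congr rfl fun i _ => integral_sq_of_gaussianReal (hd i) (hη i)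
  have hst : standardize (fun ω => ∑ i, η i ω ^ 2) P
      = fun ω => ∑ i, (η i ω ^ 2 - d i) / (v * s) := by
    ext ω
    rw [standardize, hmean, variance_sum_sq hind hη hd, Real.sqrt_mul chiSqVariance_pos.le,
      ← Finset.sum_div, Finset.sum_sub_distrib]
  have hm : ∀ i, AEMeasurable (fun ω => (η i ω ^ 2 - d i) / (v * s)) P := fun i => by
    have := (hη i).aemeasurable
    fun_prop
  have hind' : iIndepFun (fun i ω => (η i ω ^ 2 - d i) / (v * s)) P :=
    hind.comp (fun i z => (z ^ 2 - d i) / (v * s)) (by fun_prop)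
  rw [hst, hind'.charFun_map_fun_sum_eq_prod hm, Finset.prod_apply]
  refine Finset.prod_congr rfl fun i _ => ?_
  rw [← charFun_map_mul]
  congr 1
  have h1 : P.map (fun ω => (η i ω ^ 2 - d i) / (v * s))
      = (P.map fun ω => η i ω ^ 2).map fun y => (y - d i) / (v * s) := by
    rw [AEMeasurable.map_map_of_aemeasurable (by fun_prop)
      (hasLaw_sq_of_gaussianReal (hd i) (hη i)).aemeasurable]
    rfl
  rw [h1, (hasLaw_sq_of_gaussianReal (hd i) (hη i)).map_eq, chiSqLaw,
    Measure.map_map (by fun_prop) (by fun_prop), Measure.map_map (by fun_prop) (by fun_prop)]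
  congr 1 with z
  simp only [Function.comp]
  rw [← hv, div_mul_div_comm, mul_comm s v]
  congr 1
  ring

end SumSq

section QuadraticCLT

variable {Ω : Type*} [MeasurableSpace Ω] {P : Measure Ω} [IsProbabilityMeasure P]

lemma memLp_sum_sq {ι : Type*} [Fintype ι] {δ : ι → Ω → ℝ}
    (hδ : HasGaussianLaw (fun ω i => δ i ω) P) (h0 : ∀ i, ∫ ω, δ i ω ∂P = 0) :
    MemLp (fun ω => ∑ i, δ i ω ^ 2) 2 P := by
  obtain ⟨η, d, -, hlaw, hd, hsum, -, -⟩ := exists_independent_coordinates hδ h0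
  simp_rw [hsum]
  exact memLp_finsetSum _ fun i _ => memLp_sq_of_gaussianReal (hd i) (hlaw i)

lemma variance_sum_sq_eq {ι : Type*} [Fintype ι] {δ : ι → Ω → ℝ}
    (hδ : HasGaussianLaw (fun ω i => δ i ω) P) (h0 : ∀ i, ∫ ω, δ i ω ∂P = 0) :
    Var[fun ω => ∑ i, δ i ω ^ 2; P] = chiSqVariance * ∑ k, ∑ l, cov[δ k, δ l; P] ^ 2 := by
  obtain ⟨η, d, hind, hlaw, hd, hsum, hsq, -⟩ := exists_independent_coordinates hδ h0
  simp_rw [hsum]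
  rw [variance_sum_sq hind hlaw hd, hsq]

/-- The squared norms of centered Gaussian vectors are asymptotically normal as soon as the
maximal absolute row sums of the covariance matrices are negligible with respect to their
Hilbert-Schmidt norms. -/
theorem tendstoInDistribution_standardize_sum_sq {ι : ℕ → Type*} [∀ n, Fintype (ι n)]
    {δ : ∀ n, ι n → Ω → ℝ} (hδ : ∀ n, HasGaussianLaw (fun ω i => δ n i ω) P)
    (h0 : ∀ n i, ∫ ω, δ n i ω ∂P = 0) {B : ℕ → ℝ}
    (hB : ∀ᶠ n in atTop, ∀ k, ∑ l, |cov[δ n k, δ n l; P]| ≤ B n)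
    (hpos : ∀ᶠ n in atTop, 0 < ∑ k, ∑ l, cov[δ n k, δ n l; P] ^ 2)
    (hlim : Tendsto (fun n => B n / √(∑ k, ∑ l, cov[δ n k, δ n l; P] ^ 2)) atTop (𝓝 0)) :
    TendstoInDistribution (fun n => standardize (fun ω => ∑ i, δ n i ω ^ 2) P) atTop
      (fun x : ℝ => x) (fun _ => P) (gaussianReal 0 1) where
  forall_aemeasurable n := by
    have := (memLp_sum_sq (hδ n) (h0 n)).aestronglyMeasurable.aemeasurable
    unfold standardize
    fun_prop
  tendsto := by
    refine ProbabilityMeasure.tendsto_iff_tendsto_charFun.2 fun t => ?_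
    choose η d hind hlaw hd hsum hsq hrow using
      fun n => exists_independent_coordinates (hδ n) (h0 n)
    have hchar : ∀ n, charFun (P.map (standardize (fun ω => ∑ i, δ n i ω ^ 2) P)) t
        = ∏ i, charFun chiSqLaw (d n i / √(∑ i, d n i ^ 2) * t) := by
      intro n
      simp_rw [hsum n]
      exact charFun_standardize_sum_sq (hind n) (hlaw n) (hd n) t
    simp only [ProbabilityMeasure.coe_mk, Measure.map_id']
    simp_rw [hchar]
    refine tendsto_prod_charFun_chiSqLaw ?_ (e := fun n =>
      B n / √(∑ k, ∑ l, cov[δ n k, δ n l; P] ^ 2) * |t|) (by simpa using hlim.mul_const |t|) ?_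
    · filter_upwards [hpos] with n hn
      rw [← hsq] at hn
      simp_rw [mul_pow, div_pow]
      rw [← Finset.sum_mul, ← Finset.sum_div, Real.sq_sqrt hn.le, div_self hn.ne', one_mul]
    · filter_upwards [hB] with n hn i
      rw [abs_mul, ← hsq, abs_div, abs_of_nonneg (hd n i), abs_of_nonneg (Real.sqrt_nonneg _)]
      gcongr
      exact hrow n (B n) hn i

end QuadraticCLT

/-! ### The filter coefficients -/

section Coefficients

variable {Ω : Type*} [MeasurableSpace Ω] {P : Measure Ω} [IsProbabilityMeasure P]
  {X : ℝ → Ω → ℝ} {F : Measure ℝ} {ψ : ℝ → ℝ}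

lemma filterTransform_ae_eq (hX : IsStationaryGaussian X P) (hF : IsSpectralMeasure X P F)
    (hψ : Integrable ψ) {a : ℝ} (ha : 0 < a) (b : ℝ) :
    filterTransform ψ X a b =ᵐ[P] hX.integralL2 (filterKernel ψ a b) := by
  filter_upwards [hX.coeFn_integralL2 hF (integrable_filterKernel hψ ha b)] with ω hω
  rw [hω, filterTransform, ← integral_const_mul]
  congr 1 with t
  rw [filterKernel, mul_assoc]

variable {ι : Type*} [Fintype ι]

lemma hasGaussianLaw_filterTransform (hX : IsStationaryGaussian X P)
    (hF : IsSpectralMeasure X P F) (hψ : Integrable ψ) {a : ℝ} (ha : 0 < a) (b : ι → ℝ) :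
    HasGaussianLaw (fun ω i => filterTransform ψ X a (b i) ω) P := by
  have hmem := fun i => hX.integralL2_mem hF (integrable_filterKernel hψ ha (b i))
  refine (hasGaussianLaw_of_mem_gaussianSpace hX.gaussian hX.centered hX.coeFn_toL2 hmem).congr ?_
  filter_upwards [ae_all_iff.2 fun i => filterTransform_ae_eq hX hF hψ ha (b i)] with ω hω
  ext i
  exact (hω i).symm

lemma integral_filterTransform (hX : IsStationaryGaussian X P)
    (hF : IsSpectralMeasure X P F) (hψ : Integrable ψ) {a : ℝ} (ha : 0 < a) (b : ℝ) :
    ∫ ω, filterTransform ψ X a b ω ∂P = 0 := by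
  have hmem := hX.integralL2_mem hF (integrable_filterKernel hψ ha b)
  set Y := hX.integralL2 (filterKernel ψ a b)
  rw [integral_congr_ae (filterTransform_ae_eq hX hF hψ ha b),
    ← integral_id_gaussianReal (μ := 0) (v := (‖Y‖ ^ 2).toNNReal),
    ← map_eq_gaussianReal_of_mem_gaussianSpace hX.gaussian hX.centered hX.coeFn_toL2 hmem,
    integral_map (Lp.aestronglyMeasurable Y).aemeasurable (by fun_prop)]

lemma covariance_filterTransform (hX : IsStationaryGaussian X P)
    (hF : IsSpectralMeasure X P F) (hψ : Integrable ψ) {a : ℝ} (ha : 0 < a) (b b' : ℝ) :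
    cov[filterTransform ψ X a b, filterTransform ψ X a b'; P]
      = inner ℝ (hX.integralL2 (filterKernel ψ a b)) (hX.integralL2 (filterKernel ψ a b')) := by
  have h1 := filterTransform_ae_eq hX hF hψ ha b
  have h2 := filterTransform_ae_eq hX hF hψ ha b'
  rw [covariance, integral_filterTransform hX hF hψ ha, integral_filterTransform hX hF hψ ha,
    L2.inner_def]
  refine integral_congr_ae ?_
  filter_upwards [h1, h2] with ω e1 e2
  simp [e1, e2, mul_comm]

end Coefficients

lemma sum_inv_abs_sub_le (m : ℕ) {k : ℕ} (hk : k ∈ Finset.Icc 1 m) :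
    ∑ l ∈ (Finset.Icc 1 m).erase k, |(k : ℝ) - l|⁻¹ ≤ 2 * (1 + Real.log m) := by
  have hH : ∑ i ∈ Finset.Icc 1 m, (i : ℝ)⁻¹ ≤ 1 + Real.log m := by
    have := harmonic_le_one_add_log m
    rwa [harmonic_eq_sum_Icc, Rat.cast_sum, Finset.sum_congr rfl fun i _ => by
      rw [Rat.cast_inv, Rat.cast_natCast]] at this
  rw [Finset.mem_Icc] at hk
  have hsplit : (Finset.Icc 1 m).erase k = Finset.Ico 1 k ∪ Finset.Ioc k m := by
    ext l
    simp only [Finset.mem_erase, Finset.mem_Icc, Finset.mem_union, Finset.mem_Ico, Finset.mem_Ioc]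
    omega
  have hdisj : Disjoint (Finset.Ico 1 k) (Finset.Ioc k m) := by
    rw [Finset.disjoint_left]
    intro l h1 h2
    rw [Finset.mem_Ico] at h1
    rw [Finset.mem_Ioc] at h2
    omega
  rw [hsplit, Finset.sum_union hdisj, two_mul]
  -- on either side of `k`, the distances to `k` are distinct elements of `{1, …, m}`
  have hside : ∀ (s : Finset ℕ) (g : ℕ → ℕ), (∀ l ∈ s, g l ∈ Finset.Icc 1 m) → InjOn g s →
      (∀ l ∈ s, |(k : ℝ) - l| = g l) → ∑ l ∈ s, |(k : ℝ) - l|⁻¹ ≤ 1 + Real.log m := by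
    intro s g hg hinj hdist
    refine le_trans (le_of_eq ?_) (le_trans (Finset.sum_le_sum_of_subset_of_nonneg
      (Finset.image_subset_iff.2 hg) (f := fun i : ℕ => (i : ℝ)⁻¹) fun i _ _ => by positivity) hH)
    rw [Finset.sum_image hinj]
    exact Finset.sum_congr rfl fun l hl => by rw [hdist l hl]
  refine add_le_add (hside _ (fun l => k - l) ?_ ?_ ?_) (hside _ (fun l => l - k) ?_ ?_ ?_)
  · intro l hl
    rw [Finset.mem_Ico] at hl
    rw [Finset.mem_Icc]
    omega
  · intro l hl l' hl' heq
    rw [Finset.mem_coe, Finset.mem_Ico] at hl hl'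
    dsimp only at heq
    omega
  · intro l hl
    rw [Finset.mem_Ico] at hl
    rw [Nat.cast_sub hl.2.le, abs_of_nonneg]
    exact sub_nonneg.2 (Nat.cast_le.2 hl.2.le)
  · intro l hl
    rw [Finset.mem_Ioc] at hl
    rw [Finset.mem_Icc]
    omega
  · intro l hl l' hl' heq
    rw [Finset.mem_coe, Finset.mem_Ioc] at hl hl'
    dsimp only at heq
    omega
  · intro l hl
    rw [Finset.mem_Ioc] at hl
    rw [Nat.cast_sub hl.1.le, abs_sub_comm, abs_of_nonneg]
    exact sub_nonneg.2 (Nat.cast_le.2 hl.1.le)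

end

end CyclicLongMemory

theorem mainTheorem2 {Ω : Type*} [MeasurableSpace Ω] (P : Measure Ω) [IsProbabilityMeasure P]
    (X : ℝ → Ω → ℝ) (hX : CyclicLongMemory.IsStationaryGaussian X P)
    (s₀ α : ℝ) (h : ℝ → ℝ) (hmodel : CyclicLongMemory.IsCyclicModel s₀ α h)
    (hdens : CyclicLongMemory.IsSpectralDensity X P (CyclicLongMemory.cyclicDensity s₀ α h))
    (A : ℝ) (ψ : ℝ → ℝ) (hψ : CyclicLongMemory.IsFilter A ψ)
    (a : ℕ → ℝ) (ha_pos : ∀ j, 0 < a j) (ha_mono : StrictMono a)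
    (ha_top : Tendsto a atTop atTop)
    (m : ℕ → ℕ) (hm_pos : ∀ j, 0 < m j) (hm_mono : Monotone m)
    (hm_top : Tendsto m atTop atTop)
    (γ : ℕ → ℝ) (hγ_pos : ∀ j, 0 < γ j)
    (b : ℕ → ℤ → ℝ)
    (hb : ∀ (j : ℕ) (k l : ℤ), γ j * |(k : ℝ) - (l : ℝ)| ≤ |b j k - b j l|)
    (hlim : Tendsto (fun j : ℕ => a j * Real.log (m j : ℝ) / (γ j * Real.sqrt (m j : ℝ)))
      atTop (𝓝 0)) :
    -- the filter coefficients and the standardised statistic are well defined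
    (∀ (j : ℕ) (k : ℤ), ∀ᵐ ω ∂P, Integrable (fun t : ℝ => ψ ((t - b j k) / a j) * X t ω)) ∧
    (∀ j : ℕ, MemLp (CyclicLongMemory.sumSqCoeff ψ X a b m j) 2 P) ∧
    (∀ᶠ j : ℕ in atTop, 0 < variance (CyclicLongMemory.sumSqCoeff ψ X a b m j) P) ∧
    -- convergence in distribution to the standard Gaussian law
    TendstoInDistribution
      (fun (j : ℕ) (ω : Ω) =>
        CyclicLongMemory.standardize (CyclicLongMemory.sumSqCoeff ψ X a b m j) P ω)
      atTop (fun x : ℝ => x) (fun _ : ℕ => P) (gaussianReal 0 1) := by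
  have hF := hdens.isSpectralMeasure
  set δ : ∀ j : ℕ, Finset.Icc 1 (m j) → Ω → ℝ := fun j k =>
    CyclicLongMemory.filterTransform ψ X (a j) (b j ((k : ℕ) : ℤ)) with hδ
  have hsum : ∀ j, CyclicLongMemory.sumSqCoeff ψ X a b m j = fun ω => ∑ k, δ j k ω ^ 2 := by
    intro j
    ext ω
    exact (Finset.sum_coe_sort (Finset.Icc 1 (m j))
      fun k : ℕ => CyclicLongMemory.filterCoeff ψ X a b j (k : ℤ) ω ^ 2).symm
  have hG : ∀ j, HasGaussianLaw (fun ω k => δ j k ω) P := fun j =>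
    CyclicLongMemory.hasGaussianLaw_filterTransform hX hF hψ.integrable (ha_pos j)
      fun k : Finset.Icc 1 (m j) => b j ((k : ℕ) : ℤ)
  have h0 : ∀ j k, ∫ ω, δ j k ω ∂P = 0 := fun j k =>
    CyclicLongMemory.integral_filterTransform hX hF hψ.integrable (ha_pos j) _
  obtain ⟨a₀, c, C, hc, hC, hcov⟩ :=
    CyclicLongMemory.exists_covariance_bounds hX hmodel hdens hψ
  have hlarge : ∀ᶠ j in atTop, a₀ ≤ a j := ha_top.eventually_ge_atTop a₀
  -- lower bound for the Hilbert-Schmidt norm, from the diagonal of the covariance matrix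
  have hHS : ∀ᶠ j in atTop, c ^ 2 * m j ≤ ∑ k, ∑ l, cov[δ j k, δ j l; P] ^ 2 := by
    filter_upwards [hlarge] with j hj
    have hdiag : ∀ k, c ^ 2 ≤ ∑ l, cov[δ j k, δ j l; P] ^ 2 := by
      intro k
      refine le_trans ?_ (Finset.single_le_sum (f := fun l => cov[δ j k, δ j l; P] ^ 2)
        (fun l _ => sq_nonneg _) (Finset.mem_univ k))
      have := (hcov (a j) (ha_pos j) hj (b j ((k : ℕ) : ℤ)) 0).2.2
      rw [← CyclicLongMemory.covariance_filterTransform hX hF hψ.integrable (ha_pos j)] at this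
      exact pow_le_pow_left₀ hc.le this 2
    calc c ^ 2 * m j = ∑ _k : Finset.Icc 1 (m j), c ^ 2 := by
          simp [mul_comm]
      _ ≤ _ := Finset.sum_le_sum fun k _ => hdiag k
  have hpos : ∀ᶠ j in atTop, 0 < ∑ k, ∑ l, cov[δ j k, δ j l; P] ^ 2 := by
    filter_upwards [hHS] with j hj
    have : (0 : ℝ) < m j := Nat.cast_pos.2 (hm_pos j)
    exact lt_of_lt_of_le (by positivity) hj
  -- upper bound for the row sums: the off-diagonal entries are dominated by a harmonic series
  set B : ℕ → ℝ := fun j => C + C * (a j / γ j) * (2 * (1 + Real.log (m j))) with hB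
  have hrow : ∀ᶠ j in atTop, ∀ k, ∑ l, |cov[δ j k, δ j l; P]| ≤ B j := by
    filter_upwards [hlarge] with j hj k
    have hbound := fun k l : ℤ => hcov (a j) (ha_pos j) hj (b j k) (b j l)
    simp only [← CyclicLongMemory.covariance_filterTransform hX hF hψ.integrable (ha_pos j)]
      at hbound
    rw [Finset.sum_coe_sort (Finset.Icc 1 (m j)) fun l : ℕ => |cov[δ j k,
      CyclicLongMemory.filterTransform ψ X (a j) (b j (l : ℤ)); P]|,
      ← Finset.add_sum_erase _ _ k.2]
    refine add_le_add (hbound _ _).1 ?_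
    refine le_trans ?_ (mul_le_mul_of_nonneg_left (CyclicLongMemory.sum_inv_abs_sub_le (m j) k.2)
      (mul_nonneg hC.le (div_pos (ha_pos j) (hγ_pos j)).le))
    rw [Finset.mul_sum]
    refine Finset.sum_le_sum fun l hl => ?_
    have hkl : (0 : ℝ) < |((k : ℕ) : ℝ) - (l : ℝ)| :=
      abs_pos.2 (sub_ne_zero.2 (Nat.cast_injective.ne (Finset.ne_of_mem_erase hl).symm))
    have hsep := hb j ((k : ℕ) : ℤ) (l : ℤ)
    simp only [Int.cast_natCast] at hsep
    have hγkl : 0 < γ j * |((k : ℕ) : ℝ) - (l : ℝ)| := mul_pos (hγ_pos j) hkl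
    have hne : b j ((k : ℕ) : ℤ) ≠ b j (l : ℤ) :=
      sub_ne_zero.1 (abs_pos.1 (hγkl.trans_le hsep))
    refine ((hbound _ _).2.1 hne).trans ?_
    rw [mul_assoc, ← div_eq_mul_inv, div_div]
    have := (ha_pos j).le
    gcongr
  have hratio : Tendsto (fun j => B j / √(∑ k, ∑ l, cov[δ j k, δ j l; P] ^ 2)) atTop (𝓝 0) := by
    have hm' : Tendsto (fun j => (m j : ℝ)) atTop atTop :=
      tendsto_natCast_atTop_atTop.comp hm_top
    have hmaj : Tendsto (fun j => C / c * (√(m j : ℝ))⁻¹ + 4 * C / c *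
        (a j * Real.log (m j : ℝ) / (γ j * √(m j : ℝ)))) atTop (𝓝 0) := by
      have h1 := (tendsto_inv_atTop_zero.comp (Real.tendsto_sqrt_atTop.comp hm')).const_mul (C / c)
      have h2 := hlim.const_mul (4 * C / c)
      simpa using h1.add h2
    have hlog : ∀ᶠ j in atTop, 1 ≤ Real.log (m j) :=
      (Real.tendsto_log_atTop.comp hm').eventually_ge_atTop 1
    refine squeeze_zero' ?_ ?_ hmaj
    · filter_upwards [hlog] with j hj
      have := ha_pos j
      have := hγ_pos j
      positivity
    · filter_upwards [hlog, hHS] with j hj hHSj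
      have ha := ha_pos j
      have hγ := hγ_pos j
      have hmj : (0 : ℝ) < m j := Nat.cast_pos.2 (hm_pos j)
      have hsq : c * √(m j : ℝ) ≤ √(∑ k, ∑ l, cov[δ j k, δ j l; P] ^ 2) := by
        refine Real.le_sqrt_of_sq_le ?_
        rwa [mul_pow, Real.sq_sqrt hmj.le]
      calc B j / √(∑ k, ∑ l, cov[δ j k, δ j l; P] ^ 2)
          ≤ (C + C * (a j / γ j) * (4 * Real.log (m j))) / (c * √(m j : ℝ)) := by
            have h4 : 2 * (1 + Real.log (m j)) ≤ 4 * Real.log (m j) := by linarith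
            exact div_le_div₀ (by positivity) (by simp only [hB]; gcongr) (by positivity) hsq
        _ = _ := by
            have := Real.sqrt_pos.2 hmj
            field_simp
  refine ⟨fun j k => ?_, fun j => ?_, ?_, ?_⟩
  · exact (hX.integrable_prod hF
      (CyclicLongMemory.integrable_comp_filter hψ.integrable (ha_pos j) (b j k))).prod_left_ae
  · rw [hsum]
    exact CyclicLongMemory.memLp_sum_sq (hG j) (h0 j)
  · filter_upwards [hpos] with j hj
    rw [hsum, CyclicLongMemory.variance_sum_sq_eq (hG j) (h0 j)]
    exact mul_pos CyclicLongMemory.chiSqVariance_pos hj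
  · simp_rw [hsum]
    exact CyclicLongMemory.tendstoInDistribution_standardize_sum_sq hG h0 hrow hpos hratio
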